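/- Let $n\ge 1$, let $\mathbb D=\{z\in\mathbb C:|z|<1\}$ and $\mathbb T=\{\zeta\in\mathbb C:|\zeta|=1\}$, let $m_n$ be the normalized Haar measure on the torus $\mathbb T^n$, and let $\mathcal M(\mathbb T^n)$ be the space of complex Borel measures on $\mathbb T^n$. Let $\alpha=(\alpha_1,\dots,\alpha_n),\ \beta=(\beta_1,\dots,\beta_n)\in\mathbb C^n$ satisfy $\operatorname{Re}\alpha_j+\operatorname{Re}\beta_j>-1$ and $\alpha_j,\beta_j\notin\{-1,-2,-3,\dots\}$ for $1\le j\le n$. For $z\in\mathbb D^n$ and $\zeta\in\mathbb T^n$ put $$P_{\alpha,\beta}(z,\zeta)=\prod_{j=1}^n \frac{\Gamma(\alpha_j+1)\Gamma(\beta_j+1)}{\Gamma(\alpha_j+\beta_j+1)}\cdot\frac{(1-|z_j|^2)^{\alpha_j+\beta_j+1}}{(1-z_j\overline{\zeta_j})^{\alpha_j+1}(1-\overline{z_j}\zeta_j)^{\beta_j+1}}$$ (principal powers), and for $\mu\in\mathcal M(\mathbb T^n)$ put $P_{\alpha,\beta}[d\mu](z)=\int_{\mathbb T^n}P_{\alpha,\beta}(z,\zeta)\,d\mu(\zeta)$.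 For $0<A<\infty$ and $\zeta=e^{i\varphi}\in\mathbb T$ let $S_A(\zeta)=\{re^{i(\varphi-\theta)}: 0\le r<1,\ |\theta|\le A(1-r)\}$, and for $1\le B<\infty$ and $\zeta\in\mathbb T^n$ let $$S_{A,B}(\zeta)=\Big\{z\in\prod_{j=1}^n S_A(\zeta_j):\ \max_{j,k}\frac{1-|z_j|}{1-|z_k|}\le B\Big\}.$$ A function $u:\mathbb D^n\to\mathbb C$ has restricted non-tangential limit $l\in\mathbb C$ at $\zeta\in\mathbb T^n$ if, for every $0<A<\infty$ and every $1\le B<\infty$, $u(z)\to l$ as $z\to\zeta$ with $z\in S_{A,B}(\zeta)$. Let $\mu\in\mathcal M(\mathbb T^n)$ have the Lebesgue decomposition $d\mu=f\,dm_n+d\sigma$, where $f\in L^1(\mathbb T^n)$ and $\sigma\in\mathcal M(\mathbb T^n)$ is singular with respect to $m_n$. Then for $m_n$-almost every $\zeta\in\mathbb T^n$ the function $P_{\alpha,\beta}[d\mu]$ has restricted non-tangential limit $f(\zeta)$ at $\zeta$. -/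

import Mathlib

open MeasureTheory Filter Topology

noncomputable section

namespace PolydiscPoisson

/-- The Borel σ-algebra on the unit circle. -/
instance instMeasurableSpaceCircle : MeasurableSpace Circle := borel Circle

instance instBorelSpaceCircle : BorelSpace Circle := ⟨rfl⟩

/-- The unit torus `𝕋ⁿ`, as a product of `n` unit circles. -/
abbrev Torus (n : ℕ) : Type := Fin n → Circle

/-- The normalized Haar measure `m_n` on the torus, of total mass `1`. -/
def haarTorus (n : ℕ) : Measure (Torus n) :=
  Measure.haarMeasure (⊤ : TopologicalSpace.PositiveCompacts (Torus n))

/-- A point of the torus, seen as a point of `ℂⁿ`. -/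
def toComplex {n : ℕ} (ζ : Torus n) : Fin n → ℂ := fun j => (ζ j : ℂ)

/-- The constant `c_{a,b} = Γ(a+1) Γ(b+1) / Γ(a+b+1)`. -/
def coef (a b : ℂ) : ℂ :=
  Complex.Gamma (a + 1) * Complex.Gamma (b + 1) / Complex.Gamma (a + b + 1)

/-- The `(α, β)`-Poisson kernel
`∏ⱼ c_{αⱼ,βⱼ} (1-|zⱼ|²)^{αⱼ+βⱼ+1} / ((1-zⱼ ζ̄ⱼ)^{αⱼ+1} (1-z̄ⱼ ζⱼ)^{βⱼ+1})`
(principal powers; for `|zⱼ| < 1` the bases have positive real part). -/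
def abPoissonKernel {n : ℕ} (α β : Fin n → ℂ) (z : Fin n → ℂ) (ζ : Torus n) : ℂ :=
  ∏ j, coef (α j) (β j) *
    (((1 - ‖z j‖ ^ 2 : ℝ) : ℂ) ^ (α j + β j + 1) /
      ((1 - z j * (starRingEnd ℂ) (ζ j : ℂ)) ^ (α j + 1) *
        (1 - (starRingEnd ℂ) (z j) * (ζ j : ℂ)) ^ (β j + 1)))

/-- The `(α, β)`-Poisson integral of a complex Borel measure on the torus. -/
def abPoissonIntegral {n : ℕ} (α β : Fin n → ℂ) (μ : ComplexMeasure (Torus n))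
    (z : Fin n → ℂ) : ℂ :=
  VectorMeasure.integral μ (fun ζ => abPoissonKernel α β z ζ) (ContinuousLinearMap.mul ℝ ℂ)

/-- The Stolz region `{ r e^{i(φ-θ)} : 0 ≤ r < 1, |θ| ≤ A (1-r) }` at `ζ = e^{iφ}`. -/
def stolz (A : ℝ) (ζ : Circle) : Set ℂ :=
  {w | ∃ r θ : ℝ, 0 ≤ r ∧ r < 1 ∧ |θ| ≤ A * (1 - r) ∧
    w = (r : ℂ) * ((ζ : ℂ) * Complex.exp (-(θ : ℂ) * Complex.I))}

/-- The restricted Stolz cone `S_{A,B}(ζ)`: the points of the product of the Stolz regions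
`S_A(ζⱼ)` with `(1-|zⱼ|)/(1-|zₖ|) ≤ B` for all `j, k`. -/
def restrictedStolz {n : ℕ} (A B : ℝ) (ζ : Torus n) : Set (Fin n → ℂ) :=
  {z | (∀ j, z j ∈ stolz A (ζ j)) ∧ ∀ j k, (1 - ‖z j‖) / (1 - ‖z k‖) ≤ B}

/-- `u` has restricted non-tangential limit `l` at `ζ`: for all `0 < A < ∞` and `1 ≤ B < ∞`,
`u(z) → l` as `z → ζ` within `S_{A,B}(ζ)`. -/
def HasRestrictedNTLimit {n : ℕ} (u : (Fin n → ℂ) → ℂ) (ζ : Torus n) (l : ℂ) : Prop :=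
  ∀ A B : ℝ, 0 < A → 1 ≤ B →
    Tendsto u (𝓝[restrictedStolz A B ζ] (toComplex ζ)) (𝓝 l)

/-- `μ = f dm_n + σ` is the Lebesgue decomposition of the complex Borel measure `μ` with respect
to `m_n`: `f` is integrable and `σ` is singular with respect to `m_n`. -/
structure IsLebesgueDecomposition {n : ℕ} (μ : ComplexMeasure (Torus n)) (f : Torus n → ℂ)
    (σ : ComplexMeasure (Torus n)) : Prop where
  integrable : Integrable f (haarTorus n)
  singular : VectorMeasure.MutuallySingular σ (haarTorus n).toENNRealVectorMeasure
  eq_add : μ = (haarTorus n).withDensityᵥ f + σ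

end PolydiscPoisson

end

noncomputable section

namespace PolydiscPoisson

open Metric Set
open scoped ENNReal NNReal ComplexConjugate

/-! Write K for the kernel at z. Subtracting the value at ζ gives P[dμ](z) - f(ζ) = ∫ K (f - f(ζ))
dm + ∫ K dσ + f(ζ) (∫ K dm - 1), so it suffices to control |K| against |f - f(ζ)| dm + d|σ| and to
show that the total mass of K tends to 1 (`enorm_abPoissonIntegral_sub_le`).

Total mass: it factors over coordinates, and orthogonality of characters turns each factor into a
power series in |w|² whose coefficients are products of two binomial coefficients. By Euler's limit
for Γ these agree to leading order with a multiple of the coefficients of (1 - ρ)^{-(a+b+1)}; an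
Abelian argument discards the difference, and the Gamma constant normalizes the limit to 1
(`tendsto_poissonFactor_series`).

Concentration: in a restricted cone all 1 - |z_j| are comparable to one scale r. A factor at
distance about 2^k r from ζ_j is at most a constant times 2^{-εk} / (2^k r), where ε > 0 bounds
every Re α_j + Re β_j + 1 from below. Hence ∫ |K| dρ is dominated by the sum over k in ℕⁿ of
2^{-ε|k|} times the normalized mass of the box with sides 2^{k_j} r, where |k| is the sum of the k_j
(`exists_lintegral_kernel_le`).

For fixed k these boxes are comparable to balls, so Lebesgue differentiation sends each average to 0
almost everywhere. To pass to the limit under the sum, apply Vitali covering to one shape at a time: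
the weak (1,1) constant does not depend on k. With q² = 2^{-ε}, Borel-Cantelli then bounds the
averages of |f| dm + d|σ| by q^{-|k|} for all but finitely many k at almost every ζ, and dominated
convergence applies (`ae_tendsto_tsum_oscMeasure_box`). No strong maximal function, over all shapes
at once, is needed. -/

/-! ### Haar measure of arcs and polyarcs; doubling -/

/-- The normalized Haar measure on the unit circle. -/
def haarCircle : Measure Circle :=
  Measure.haarMeasure (⊤ : TopologicalSpace.PositiveCompacts Circle)

instance instIsHaarMeasureCircle : haarCircle.IsHaarMeasure := by
  unfold haarCircle; infer_instance

instance instIsProbabilityMeasureCircle : IsProbabilityMeasure haarCircle :=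
  ⟨Measure.haarMeasure_self (K₀ := (⊤ : TopologicalSpace.PositiveCompacts Circle))⟩

instance instIsHaarMeasureTorus (n : ℕ) : (haarTorus n).IsHaarMeasure := by
  unfold haarTorus; infer_instance

instance instIsProbabilityMeasureTorus (n : ℕ) : IsProbabilityMeasure (haarTorus n) :=
  ⟨Measure.haarMeasure_self (K₀ := (⊤ : TopologicalSpace.PositiveCompacts (Torus n)))⟩

theorem haarTorus_eq_pi (n : ℕ) : haarTorus n = Measure.pi fun _ : Fin n => haarCircle := by
  have h := Measure.haarMeasure_unique (Measure.pi fun _ : Fin n => haarCircle)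
    (⊤ : TopologicalSpace.PositiveCompacts (Torus n))
  rw [h]
  simp [haarTorus]

instance instFactTwoPiPos : Fact (0 < 2 * Real.pi) := ⟨Real.two_pi_pos⟩

/-- The Haar measure on the circle is the image of the normalized Lebesgue measure on angles. -/
theorem haarCircle_eq_map : haarCircle =
    (ENNReal.ofReal (2 * Real.pi))⁻¹ •
      Measure.map (AddCircle.toCircle (T := 2 * Real.pi)) volume := by
  have hm : Measurable (AddCircle.toCircle (T := 2 * Real.pi)) :=
    AddCircle.continuous_toCircle.measurable
  set ν : Measure Circle := Measure.map (AddCircle.toCircle (T := 2 * Real.pi)) volume with hν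
  have hsurj : Function.Surjective (AddCircle.toCircle (T := 2 * Real.pi)) :=
    fun z => by
      obtain ⟨x, hx⟩ :=
        (AddCircle.homeomorphCircle (T := 2 * Real.pi) Real.two_pi_pos.ne').surjective z
      exact ⟨x, by rw [← hx, AddCircle.homeomorphCircle_apply]⟩
  have : ν.IsMulLeftInvariant := by
    refine ⟨fun g => ?_⟩
    obtain ⟨a, rfl⟩ := hsurj g
    rw [hν, Measure.map_map (measurable_const_mul _) hm]
    have : ((AddCircle.toCircle a * ·) ∘ (AddCircle.toCircle (T := 2 * Real.pi)))
        = (AddCircle.toCircle (T := 2 * Real.pi)) ∘ (a + ·) := by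
      ext x; simp [AddCircle.toCircle_add]
    rw [this, ← Measure.map_map hm (measurable_const_add a), map_add_left_eq_self]
  have : IsFiniteMeasure ν := by rw [hν]; infer_instance
  have h := Measure.haarMeasure_unique ν (⊤ : TopologicalSpace.PositiveCompacts Circle)
  have hu : ν univ = ENNReal.ofReal (2 * Real.pi) := by
    rw [hν, Measure.map_apply hm MeasurableSet.univ]
    simp [AddCircle.measure_univ]
  have h0 : ENNReal.ofReal (2 * Real.pi) ≠ 0 := by simp [Real.pi_pos]
  rw [h]
  simp only [TopologicalSpace.PositiveCompacts.coe_top, hu]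
  rw [smul_smul, ENNReal.inv_mul_cancel h0 ENNReal.ofReal_ne_top, one_smul, haarCircle]

theorem dist_exp_one (x : ℝ) : dist (Circle.exp x) 1 = 2 * |Real.sin (x / 2)| := by
  change dist (Circle.exp x : ℂ) ((1 : Circle) : ℂ) = _
  rw [dist_eq_norm, Circle.coe_exp, Circle.coe_one, mul_comm,
    Complex.norm_exp_I_mul_ofReal_sub_one, norm_mul]
  simp

theorem exists_real_rep (x : AddCircle (2 * Real.pi)) :
    ∃ y : ℝ, |y| ≤ Real.pi ∧ ‖x‖ = |y| ∧ AddCircle.toCircle x = Circle.exp y := by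
  obtain ⟨y, hy⟩ := (AddCircle.equivIoc (2 * Real.pi) (-Real.pi)).symm.surjective x
  have hyI := y.2
  have hle : |(y : ℝ)| ≤ Real.pi := by
    rw [abs_le]; constructor
    · exact hyI.1.le
    · have := hyI.2; linarith
  have hx : x = ((y : ℝ) : AddCircle (2 * Real.pi)) := hy.symm
  refine ⟨y, hle, ?_, ?_⟩
  · rw [hx, AddCircle.norm_coe_eq_abs_iff _ Real.two_pi_pos.ne', abs_of_pos Real.two_pi_pos]
    linarith
  · rw [hx, AddCircle.toCircle_apply_mk]
    congr 1
    field_simp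

theorem dist_toCircle_one_le (x : AddCircle (2 * Real.pi)) :
    dist (AddCircle.toCircle x) 1 ≤ ‖x‖ := by
  obtain ⟨y, -, h1, h2⟩ := exists_real_rep x
  rw [h1, h2, dist_exp_one]
  have := Real.abs_sin_le_abs (x := y / 2)
  rw [abs_div, abs_two] at this
  linarith

/-- Jordan's inequality for the sine on [0, π/2]: a chord is at least 2/π times its angle. -/
theorem norm_le_dist_toCircle_one (x : AddCircle (2 * Real.pi)) :
    2 / Real.pi * ‖x‖ ≤ dist (AddCircle.toCircle x) 1 := by
  obtain ⟨y, h0, h1, h2⟩ := exists_real_rep x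
  rw [h1, h2, dist_exp_one]
  have := Real.mul_abs_le_abs_sin (x := y / 2) (by rw [abs_div, abs_two]; linarith)
  rw [abs_div, abs_two] at this
  linarith

theorem haarCircle_closedBall (x : Circle) (s : ℝ) :
    haarCircle (closedBall x s) = haarCircle (closedBall 1 s) := by
  have h : closedBall x s = (x⁻¹ * ·) ⁻¹' closedBall 1 s := by
    ext y
    simp only [mem_closedBall, mem_preimage]
    change dist (y : ℂ) x ≤ s ↔ dist ((x⁻¹ * y : Circle) : ℂ) ((1 : Circle) : ℂ) ≤ s
    have h : ((x⁻¹ * y : Circle) : ℂ) - ((1 : Circle) : ℂ) = (x⁻¹ : Circle) * ((y : ℂ) - x) := by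
      rw [mul_sub, ← Circle.coe_mul, ← Circle.coe_mul, inv_mul_cancel]
    rw [dist_eq_norm, dist_eq_norm, h, norm_mul, Circle.norm_coe, one_mul]
  rw [h, measure_preimage_mul]

theorem haarCircle_closedBall_le (x : Circle) (s : ℝ) :
    haarCircle (closedBall x s) ≤ ENNReal.ofReal s := by
  rcases lt_or_ge s 0 with hs | hs
  · simp [closedBall_eq_empty.2 hs]
  have h0 : ENNReal.ofReal (2 * Real.pi) ≠ 0 := by simp [Real.pi_pos]
  have hm : Measurable (AddCircle.toCircle (T := 2 * Real.pi)) :=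
    AddCircle.continuous_toCircle.measurable
  rw [haarCircle_closedBall, haarCircle_eq_map, Measure.smul_apply,
    Measure.map_apply hm measurableSet_closedBall, smul_eq_mul,
    ENNReal.inv_mul_le_iff h0 ENNReal.ofReal_ne_top, ← ENNReal.ofReal_mul Real.two_pi_pos.le]
  have hsub : (AddCircle.toCircle (T := 2 * Real.pi)) ⁻¹' closedBall 1 s ⊆
      closedBall 0 (Real.pi / 2 * s) := by
    intro y hy
    simp only [mem_preimage, mem_closedBall, dist_zero_right] at hy ⊢
    have h := (norm_le_dist_toCircle_one y).trans hy
    have hp := Real.pi_pos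
    rw [div_mul_eq_mul_div, div_le_iff₀ hp] at h
    linarith
  refine (measure_mono hsub).trans ?_
  rw [AddCircle.volume_closedBall]
  apply ENNReal.ofReal_le_ofReal
  have := mul_nonneg Real.pi_pos.le hs
  exact (min_le_right _ _).trans (by linarith)

/-- Chords are shorter than angles, so the ball contains an arc of angular length 2s, of measure s/π
≥ s/4. -/
theorem le_haarCircle_closedBall (x : Circle) {s : ℝ} (hs : s ≤ 1) :
    ENNReal.ofReal (s / 4) ≤ haarCircle (closedBall x s) := by
  have h0 : ENNReal.ofReal (2 * Real.pi) ≠ 0 := by simp [Real.pi_pos]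
  have hm : Measurable (AddCircle.toCircle (T := 2 * Real.pi)) :=
    AddCircle.continuous_toCircle.measurable
  rw [haarCircle_closedBall, haarCircle_eq_map, Measure.smul_apply,
    Measure.map_apply hm measurableSet_closedBall, smul_eq_mul, mul_comm, ← div_eq_mul_inv,
    ENNReal.le_div_iff_mul_le (.inl h0) (.inl ENNReal.ofReal_ne_top)]
  by_cases hs0 : 0 ≤ s
  swap
  · rw [ENNReal.ofReal_of_nonpos (by linarith), zero_mul]; exact zero_le
  have hsub : closedBall 0 s ⊆ (AddCircle.toCircle (T := 2 * Real.pi)) ⁻¹' closedBall 1 s := by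
    intro y hy
    simp only [mem_preimage, mem_closedBall, dist_zero_right] at hy ⊢
    exact (dist_toCircle_one_le y).trans hy
  refine le_trans ?_ (measure_mono hsub)
  have hp := Real.pi_gt_three
  have hp4 := Real.pi_le_four
  rw [AddCircle.volume_closedBall, ← ENNReal.ofReal_mul (by positivity)]
  apply ENNReal.ofReal_le_ofReal
  rw [min_eq_right (by linarith)]
  nlinarith

theorem haarTorus_pi_closedBall {n : ℕ} (ζ : Torus n) (s : Fin n → ℝ) :
    haarTorus n (Set.pi univ fun j => closedBall (ζ j) (s j)) =
      ∏ j, haarCircle (closedBall (ζ j) (s j)) := by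
  rw [haarTorus_eq_pi, Measure.pi_pi]

theorem haarTorus_pi_closedBall_le {n : ℕ} (ζ : Torus n) {s : Fin n → ℝ} (hs : ∀ j, 0 ≤ s j) :
    haarTorus n (Set.pi univ fun j => closedBall (ζ j) (s j)) ≤ ENNReal.ofReal (∏ j, s j) := by
  rw [haarTorus_pi_closedBall, ENNReal.ofReal_prod_of_nonneg fun j _ => hs j]
  exact Finset.prod_le_prod' fun j _ => haarCircle_closedBall_le _ _

theorem haarTorus_closedBall_le {n : ℕ} (ζ : Torus n) {s : ℝ} (hs : 0 ≤ s) :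
    haarTorus n (closedBall ζ s) ≤ ENNReal.ofReal (s ^ n) := by
  rw [closedBall_pi _ hs]
  simpa using haarTorus_pi_closedBall_le ζ (s := fun _ => s) fun _ => hs

theorem le_haarTorus_closedBall {n : ℕ} (ζ : Torus n) {s : ℝ} (hs : 0 ≤ s) (hs1 : s ≤ 1) :
    ENNReal.ofReal ((s / 4) ^ n) ≤ haarTorus n (closedBall ζ s) := by
  rw [closedBall_pi _ hs, haarTorus_pi_closedBall]
  calc ENNReal.ofReal ((s / 4) ^ n) = ∏ _j : Fin n, ENNReal.ofReal (s / 4) := by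
        rw [Finset.prod_const, Finset.card_univ, Fintype.card_fin,
          ENNReal.ofReal_pow (by positivity)]
    _ ≤ _ := Finset.prod_le_prod' fun j _ => le_haarCircle_closedBall _ hs1

instance instIsUnifLocDoublingMeasureTorus (n : ℕ) : IsUnifLocDoublingMeasure (haarTorus n) := by
  -- 8 is the ratio of the upper bound 2ε to the lower bound ε/4 in each coordinate.
  refine ⟨⟨8 ^ n, ?_⟩⟩
  filter_upwards [Ioc_mem_nhdsGT (zero_lt_one' ℝ)] with ε hε ζ
  have h0 : 0 ≤ ε := hε.1.le
  calc haarTorus n (closedBall ζ (2 * ε)) ≤ ENNReal.ofReal ((2 * ε) ^ n) :=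
        haarTorus_closedBall_le ζ (by positivity)
    _ = ((8 ^ n : ℝ≥0) : ℝ≥0∞) * ENNReal.ofReal ((ε / 4) ^ n) := by
        rw [← ENNReal.ofReal_coe_nnreal, ← ENNReal.ofReal_mul (by positivity)]
        congr 1
        push_cast
        rw [← mul_pow]
        ring_nf
    _ ≤ _ := by gcongr; exact le_haarTorus_closedBall ζ h0 hε.2

/-! ### Boxes of a fixed shape and their maximal inequality -/

/-- The box centred at `ζ` whose `j`-th side is the arc of chordal radius `2 ^ k j * r`. -/
def box {n : ℕ} (k : Fin n → ℕ) (r : ℝ) (ζ : Torus n) : Set (Torus n) :=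
  Set.pi univ fun j => closedBall (ζ j) (2 ^ k j * r)

/-- The size of `box k r ζ`, up to a factor depending only on the dimension. -/
def boxSize {n : ℕ} (k : Fin n → ℕ) (r : ℝ) : ℝ := ∏ j, 2 ^ k j * r

theorem boxSize_pos {n : ℕ} (k : Fin n → ℕ) {r : ℝ} (hr : 0 < r) : 0 < boxSize k r :=
  Finset.prod_pos fun _ _ => by positivity

theorem boxSize_mul {n : ℕ} (k : Fin n → ℕ) (c r : ℝ) :
    boxSize k (c * r) = c ^ n * boxSize k r := by
  simp only [boxSize, Finset.prod_mul_distrib, Finset.prod_const, Finset.card_univ,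
    Fintype.card_fin]
  ring

theorem measurableSet_box {n : ℕ} (k : Fin n → ℕ) (r : ℝ) (ζ : Torus n) :
    MeasurableSet (box k r ζ) :=
  MeasurableSet.univ_pi fun _ => measurableSet_closedBall

theorem haarTorus_box_le {n : ℕ} (k : Fin n → ℕ) {r : ℝ} (hr : 0 ≤ r) (ζ : Torus n) :
    haarTorus n (box k r ζ) ≤ ENNReal.ofReal (boxSize k r) :=
  haarTorus_pi_closedBall_le ζ fun _ => by positivity

theorem ball_subset_box {n : ℕ} (k : Fin n → ℕ) {r : ℝ} (hr : 0 < r) (ζ : Torus n) :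
    ball ζ r ⊆ box k r ζ := by
  intro η hη j _
  have h1 : dist (η j) (ζ j) < r := (dist_le_pi_dist η ζ j).trans_lt hη
  have h2 : (1 : ℝ) ≤ 2 ^ k j := one_le_pow₀ one_le_two
  rw [mem_closedBall]
  nlinarith

theorem box_subset_closedBall {n : ℕ} (k : Fin n → ℕ) {r : ℝ} (hr : 0 ≤ r) (ζ : Torus n) :
    box k r ζ ⊆ closedBall ζ (2 ^ (∑ j, k j) * r) := by
  intro η hη
  rw [mem_closedBall, dist_pi_le_iff (by positivity)]
  intro j
  refine (mem_closedBall.1 (hη j trivial)).trans ?_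
  gcongr
  · exact one_le_two
  · exact Finset.single_le_sum (f := k) (fun _ _ => Nat.zero_le _) (Finset.mem_univ j)

/-- The weak type `(1,1)` inequality for boxes of a fixed shape, with a constant that does not
depend on the shape. -/
theorem haarTorus_box_maximal_le {n : ℕ} (ρ : Measure (Torus n)) [IsFiniteMeasure ρ]
    (k : Fin n → ℕ) {t : ℝ≥0∞} (ht : t ≠ 0) (ht' : t ≠ ∞) :
    haarTorus n {ζ | ∃ r ∈ Ioc (0 : ℝ) 1, t * ENNReal.ofReal (boxSize k r) < ρ (box k r ζ)} ≤
      ENNReal.ofReal (3 ^ n) * (t⁻¹ * ρ univ) := by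
  set A := {ζ : Torus n | ∃ r ∈ Ioc (0 : ℝ) 1,
    t * ENNReal.ofReal (boxSize k r) < ρ (box k r ζ)} with hA
  have hch : ∀ ζ : Torus n, ∃ r : ℝ, ζ ∈ A → r ∈ Ioc (0 : ℝ) 1 ∧
      t * ENNReal.ofReal (boxSize k r) < ρ (box k r ζ) := by
    intro ζ
    by_cases h : ζ ∈ A
    · obtain ⟨r, hr⟩ := h
      exact ⟨r, fun _ => hr⟩
    · exact ⟨0, fun h' => absurd h' h⟩
  choose r hr using hch
  -- Boxes of one shape behave like balls under scaling. Only the centres have to be covered again: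
  -- if boxes at a and b meet and r a ≤ 2 r b, then a lies in the box at b enlarged by 1 + 2 = 3.
  obtain ⟨u, huA, hdisj, hcov⟩ := Vitali.exists_disjoint_subfamily_covering_enlargement
    (fun ζ => box k (r ζ) ζ) A r 2 one_lt_two (fun a ha => (hr a ha).1.1.le) 1
    (fun a ha => (hr a ha).1.2)
    (fun a ha => ⟨a, ball_subset_box k (hr a ha).1.1 a (mem_ball_self (hr a ha).1.1)⟩)
  have hucount : u.Countable := by
    refine hdisj.countable_of_nonempty_interior fun a ha => ?_
    have h0 := (hr a (huA ha)).1.1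
    exact ⟨a, isOpen_ball.subset_interior_iff.2 (ball_subset_box k h0 a) (mem_ball_self h0)⟩
  have hsub : A ⊆ ⋃ b ∈ u, box k (3 * r b) b := by
    intro a ha
    obtain ⟨b, hb, ⟨z, hza, hzb⟩, hab⟩ := hcov a ha
    refine mem_iUnion₂.2 ⟨b, hb, fun j _ => ?_⟩
    have h1 := mem_closedBall.1 (hza j trivial)
    have h2 := mem_closedBall.1 (hzb j trivial)
    have h3 : (0 : ℝ) < 2 ^ k j := by positivity
    rw [mem_closedBall]
    have := dist_triangle_left (a j) (b j) (z j)
    nlinarith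
  have hcu := hucount.to_subtype
  calc haarTorus n A ≤ haarTorus n (⋃ b ∈ u, box k (3 * r b) b) := measure_mono hsub
    _ ≤ ∑' b : u, haarTorus n (box k (3 * r b) b) := measure_biUnion_le _ hucount _
    _ ≤ ∑' b : u, ENNReal.ofReal (3 ^ n) * (t⁻¹ * ρ (box k (r b) b)) := by
        refine ENNReal.tsum_le_tsum fun b => ?_
        have hb := hr b (huA b.2)
        have h0 := hb.1.1
        refine (haarTorus_box_le k (by positivity) _).trans ?_
        rw [boxSize_mul, ENNReal.ofReal_mul (by positivity)]
        gcongr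
        rw [← ENNReal.mul_le_iff_le_inv ht ht']
        exact hb.2.le
    _ = ENNReal.ofReal (3 ^ n) * (t⁻¹ * ρ (⋃ b ∈ u, box k (r b) b)) := by
        rw [ENNReal.tsum_mul_left, ENNReal.tsum_mul_left,
          measure_biUnion hucount hdisj fun _ _ => measurableSet_box _ _ _]
    _ ≤ _ := by gcongr; exact subset_univ _

/-- Every finite set of exponents lies in a cube, over which the sum is a product of n partial
geometric sums. -/
theorem tsum_pow_sum_ne_top (n : ℕ) {q : ℝ≥0∞} (hq : q < 1) :
    ∑' k : Fin n → ℕ, q ^ (∑ j, k j) ≠ ∞ := by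
  have hfin : (1 - q)⁻¹ ^ n ≠ ∞ :=
    ENNReal.pow_ne_top (ENNReal.inv_ne_top.2 (tsub_pos_of_lt hq).ne')
  refine ne_top_of_le_ne_top hfin ?_
  rw [ENNReal.tsum_eq_iSup_sum]
  refine iSup_le fun s => ?_
  set N := s.sup fun k => ∑ j, k j
  have hs : s ⊆ Fintype.piFinset fun _ : Fin n => Finset.range (N + 1) := by
    intro k hk
    rw [Fintype.mem_piFinset]
    intro j
    rw [Finset.mem_range, Nat.lt_succ_iff]
    exact (Finset.single_le_sum (f := k) (fun _ _ => Nat.zero_le _) (Finset.mem_univ j)).trans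
      (Finset.le_sup (f := fun k : Fin n → ℕ => ∑ j, k j) hk)
  calc ∑ k ∈ s, q ^ (∑ j, k j)
      ≤ ∑ k ∈ Fintype.piFinset fun _ : Fin n => Finset.range (N + 1), q ^ (∑ j, k j) :=
        Finset.sum_le_sum_of_subset hs
    _ = ∏ _j : Fin n, ∑ i ∈ Finset.range (N + 1), q ^ i := by
        rw [Finset.prod_univ_sum]
        exact Finset.sum_congr rfl fun k _ => (Finset.prod_pow_eq_pow_sum _ _ _).symm
    _ ≤ ∏ _j : Fin n, (1 - q)⁻¹ := by
        refine Finset.prod_le_prod' fun j _ => ?_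
        rw [← ENNReal.tsum_geometric]
        exact ENNReal.sum_le_tsum _
    _ = (1 - q)⁻¹ ^ n := by simp

/-- Borel-Cantelli: the weak-type bound at height q^{-|k|} is a constant times q^{|k|}, which is
summable over k because the constant is uniform in the shape. -/
theorem ae_finite_box_maximal {n : ℕ} (ρ : Measure (Torus n)) [IsFiniteMeasure ρ]
    {q : ℝ≥0∞} (hq0 : q ≠ 0) (hq : q < 1) :
    ∀ᵐ ζ ∂haarTorus n, {k : Fin n → ℕ | ∃ r ∈ Ioc (0 : ℝ) 1,
      (q ^ (∑ j, k j))⁻¹ * ENNReal.ofReal (boxSize k r) < ρ (box k r ζ)}.Finite := by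
  refine ae_finite_setOfPred_mem (s := fun k : Fin n → ℕ => {ζ : Torus n | ∃ r ∈ Ioc (0 : ℝ) 1,
      (q ^ (∑ j, k j))⁻¹ * ENNReal.ofReal (boxSize k r) < ρ (box k r ζ)}) ?_
  have hle : ∀ k : Fin n → ℕ, haarTorus n {ζ : Torus n | ∃ r ∈ Ioc (0 : ℝ) 1,
      (q ^ (∑ j, k j))⁻¹ * ENNReal.ofReal (boxSize k r) < ρ (box k r ζ)} ≤
      ENNReal.ofReal (3 ^ n) * ρ univ * q ^ (∑ j, k j) := by
    intro k
    refine (haarTorus_box_maximal_le ρ k ?_ ?_).trans_eq ?_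
    · exact ENNReal.inv_ne_zero.2 (ENNReal.pow_ne_top hq.ne_top)
    · exact ENNReal.inv_ne_top.2 (pow_ne_zero _ hq0)
    · rw [inv_inv]; ring
  refine ne_top_of_le_ne_top ?_ (ENNReal.tsum_le_tsum hle)
  rw [ENNReal.tsum_mul_left]
  exact ENNReal.mul_ne_top (ENNReal.mul_ne_top ENNReal.ofReal_ne_top (measure_ne_top _ _))
    (tsum_pow_sum_ne_top n hq)

/-! ### Averages of the oscillation at almost every point -/

/-- The measure `|f - f(ζ)| dm + dτ`, whose averages near `ζ` control boundary convergence. -/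
def oscMeasure {n : ℕ} (f : Torus n → ℂ) (τ : Measure (Torus n)) (ζ : Torus n) :
    Measure (Torus n) :=
  (haarTorus n).withDensity (fun η => ‖f η - f ζ‖ₑ) + τ

/-- Almost every ζ is a Lebesgue point of f at which τ has zero density; both facts come from the
Vitali family of the doubling measure. -/
theorem ae_tendsto_oscMeasure_closedBall {n : ℕ} {f : Torus n → ℂ}
    (hf : Integrable f (haarTorus n)) {τ : Measure (Torus n)} [IsFiniteMeasure τ]
    (hτ : τ ⟂ₘ haarTorus n) :
    ∀ᵐ ζ ∂haarTorus n, Tendsto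
      (fun r => oscMeasure f τ ζ (closedBall ζ r) / haarTorus n (closedBall ζ r))
      (𝓝[>] 0) (𝓝 0) := by
  set v := IsUnifLocDoublingMeasure.vitaliFamily (haarTorus n) 1
  filter_upwards [v.ae_tendsto_lintegral_enorm_sub_div_of_integrable hf,
    v.ae_eventually_measure_zero_of_singular hτ] with ζ h1 h2
  have hball : Tendsto (fun r : ℝ => closedBall ζ r) (𝓝[>] 0) (v.filterAt ζ) :=
    IsUnifLocDoublingMeasure.tendsto_closedBall_filterAt (haarTorus n) (fun _ : ℝ => ζ) id
      tendsto_id (by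
        filter_upwards [self_mem_nhdsWithin] with r hr
        exact mem_closedBall_self (by simpa using le_of_lt (mem_Ioi.1 hr)))
  have h := (h1.add h2).comp hball
  rw [add_zero] at h
  refine h.congr fun r => ?_
  simp only [Function.comp_apply, oscMeasure, Measure.add_apply,
    withDensity_apply _ measurableSet_closedBall, ENNReal.add_div]

/-- A box of shape k sits in the ball of radius M r, at a cost of a factor M ^ n. That factor grows
with k, so the convergence is not uniform in the shape. -/
theorem tendsto_oscMeasure_box {n : ℕ} {f : Torus n → ℂ} {τ : Measure (Torus n)} {ζ : Torus n}
    (h : Tendsto (fun r => oscMeasure f τ ζ (closedBall ζ r) / haarTorus n (closedBall ζ r))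
      (𝓝[>] 0) (𝓝 0)) (k : Fin n → ℕ) :
    Tendsto (fun r => oscMeasure f τ ζ (box k r ζ) / ENNReal.ofReal (boxSize k r))
      (𝓝[>] 0) (𝓝 0) := by
  set M : ℝ := 2 ^ (∑ j, k j) with hM
  have hM0 : 0 < M := by positivity
  have hlim : Tendsto (fun r : ℝ => M * r) (𝓝[>] 0) (𝓝[>] 0) := by
    refine tendsto_nhdsWithin_iff.2 ⟨?_, ?_⟩
    · have : Tendsto (fun r : ℝ => M * r) (𝓝 0) (𝓝 (M * 0)) := tendsto_id.const_mul M
      rw [mul_zero] at this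
      exact this.mono_left nhdsWithin_le_nhds
    · filter_upwards [self_mem_nhdsWithin] with r hr
      exact mul_pos hM0 hr
  have h' := ENNReal.Tendsto.const_mul (a := ENNReal.ofReal (M ^ n)) (h.comp hlim)
    (.inr ENNReal.ofReal_ne_top)
  rw [mul_zero] at h'
  refine tendsto_of_tendsto_of_tendsto_of_le_of_le' tendsto_const_nhds h'
    (Eventually.of_forall fun _ => zero_le) ?_
  filter_upwards [self_mem_nhdsWithin] with r hr
  have hr0 : 0 < r := hr
  have hcb : haarTorus n (closedBall ζ (M * r)) ≤
      ENNReal.ofReal (M ^ n) * ENNReal.ofReal (boxSize k r) := by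
    refine (haarTorus_closedBall_le ζ (by positivity)).trans ?_
    rw [← ENNReal.ofReal_mul (by positivity), mul_pow]
    apply ENNReal.ofReal_le_ofReal
    gcongr
    calc r ^ n = ∏ _j : Fin n, r := by simp
      _ ≤ boxSize k r := Finset.prod_le_prod (fun _ _ => hr0.le) fun j _ =>
          le_mul_of_one_le_left hr0.le (one_le_pow₀ one_le_two)
  have hs0 : ENNReal.ofReal (boxSize k r) ≠ 0 := by simpa using boxSize_pos k hr0
  have hm0 : haarTorus n (closedBall ζ (M * r)) ≠ 0 :=
    (measure_closedBall_pos _ ζ (mul_pos hM0 hr0)).ne'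
  simp only [Function.comp_apply]
  rw [ENNReal.div_le_iff hs0 ENNReal.ofReal_ne_top]
  calc oscMeasure f τ ζ (box k r ζ) ≤ oscMeasure f τ ζ (closedBall ζ (M * r)) :=
        measure_mono (box_subset_closedBall k hr0.le ζ)
    _ = oscMeasure f τ ζ (closedBall ζ (M * r)) / haarTorus n (closedBall ζ (M * r)) *
          haarTorus n (closedBall ζ (M * r)) :=
        (ENNReal.div_mul_cancel hm0 (measure_ne_top _ _)).symm
    _ ≤ oscMeasure f τ ζ (closedBall ζ (M * r)) / haarTorus n (closedBall ζ (M * r)) *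
          (ENNReal.ofReal (M ^ n) * ENNReal.ofReal (boxSize k r)) := by gcongr
    _ = _ := by ring

theorem oscMeasure_le {n : ℕ} (f : Torus n → ℂ) (τ : Measure (Torus n)) (ζ : Torus n)
    {E : Set (Torus n)} (hE : MeasurableSet E) :
    oscMeasure f τ ζ E ≤
      ((haarTorus n).withDensity (fun η => ‖f η‖ₑ) + τ) E + ‖f ζ‖ₑ * haarTorus n E := by
  rw [oscMeasure, Measure.add_apply, Measure.add_apply, withDensity_apply _ hE,
    withDensity_apply _ hE, add_right_comm]
  gcongr
  calc ∫⁻ η in E, ‖f η - f ζ‖ₑ ∂haarTorus n ≤ ∫⁻ η in E, (‖f η‖ₑ + ‖f ζ‖ₑ) ∂haarTorus n :=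
        lintegral_mono fun η => enorm_sub_le
    _ = _ := by
        rw [lintegral_add_right _ measurable_const, setLIntegral_const]

/-- At almost every point the weighted sums of averages over all boxes shrink to zero. -/
theorem ae_tendsto_tsum_oscMeasure_box {n : ℕ} {f : Torus n → ℂ}
    (hf : Integrable f (haarTorus n)) {τ : Measure (Torus n)} [IsFiniteMeasure τ]
    (hτ : τ ⟂ₘ haarTorus n) {q : ℝ≥0∞} (hq0 : q ≠ 0) (hq : q < 1) :
    ∀ᵐ ζ ∂haarTorus n, Tendsto (fun r => ∑' k : Fin n → ℕ, (q ^ 2) ^ (∑ j, k j) *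
      (oscMeasure f τ ζ (box k r ζ) / ENNReal.ofReal (boxSize k r))) (𝓝[>] 0) (𝓝 0) := by
  have hfin : IsFiniteMeasure ((haarTorus n).withDensity (fun η => ‖f η‖ₑ)) :=
    isFiniteMeasure_withDensity hf.2.ne
  filter_upwards [ae_tendsto_oscMeasure_closedBall hf hτ,
    ae_finite_box_maximal ((haarTorus n).withDensity (fun η => ‖f η‖ₑ) + τ) hq0 hq]
    with ζ hζ hF
  have hlim := tendsto_oscMeasure_box hζ
  set F := {k : Fin n → ℕ | ∃ r ∈ Ioc (0 : ℝ) 1,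
      (q ^ (∑ j, k j))⁻¹ * ENNReal.ofReal (boxSize k r) <
        ((haarTorus n).withDensity (fun η => ‖f η‖ₑ) + τ) (box k r ζ)} with hFdef
  -- The finitely many exceptional shapes are handled by their individual limits, once r is small.
  have hbad : ∀ᶠ r in 𝓝[>] (0 : ℝ), ∀ k ∈ F,
      oscMeasure f τ ζ (box k r ζ) / ENNReal.ofReal (boxSize k r) ≤ 1 := by
    rw [eventually_all_finite hF]
    intro k _
    exact ((hlim k).eventually_lt_const zero_lt_one).mono fun _ h => h.le
  have hqn : ∀ m : ℕ, q ^ m ≤ 1 := fun m => pow_le_one' hq.le m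
  -- One power of q absorbs the growth q^{-|k|} of the averages; the other makes the majorant
  -- summable.
  have hbound : ∀ᶠ r in 𝓝[>] (0 : ℝ), ∀ k : Fin n → ℕ, (q ^ 2) ^ (∑ j, k j) *
      (oscMeasure f τ ζ (box k r ζ) / ENNReal.ofReal (boxSize k r)) ≤
      (1 + ‖f ζ‖ₑ) * q ^ (∑ j, k j) := by
    filter_upwards [hbad, Ioc_mem_nhdsGT (zero_lt_one' ℝ)] with r hr hr1 k
    have hsq : (q ^ 2) ^ (∑ j, k j) = q ^ (∑ j, k j) * q ^ (∑ j, k j) := by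
      rw [← pow_mul, ← pow_add]; ring_nf
    have hqt : q ^ (∑ j, k j) ≠ ∞ := ENNReal.pow_ne_top hq.ne_top
    have hq0' : q ^ (∑ j, k j) ≠ 0 := pow_ne_zero _ hq0
    by_cases hk : k ∈ F
    · calc (q ^ 2) ^ (∑ j, k j) *
          (oscMeasure f τ ζ (box k r ζ) / ENNReal.ofReal (boxSize k r))
          ≤ (1 * q ^ (∑ j, k j)) * 1 := by
            rw [hsq]; gcongr
            · exact hqn _
            · exact hr k hk
        _ ≤ _ := by rw [mul_one]; gcongr; exact le_self_add
    · have hk' : ((haarTorus n).withDensity (fun η => ‖f η‖ₑ) + τ) (box k r ζ) ≤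
          (q ^ (∑ j, k j))⁻¹ * ENNReal.ofReal (boxSize k r) := by
        by_contra hcon
        exact hk ⟨r, hr1, not_le.1 hcon⟩
      have hs0 : ENNReal.ofReal (boxSize k r) ≠ 0 := by simpa using boxSize_pos k hr1.1
      have hav : oscMeasure f τ ζ (box k r ζ) / ENNReal.ofReal (boxSize k r) ≤
          (q ^ (∑ j, k j))⁻¹ + ‖f ζ‖ₑ := by
        rw [ENNReal.div_le_iff hs0 ENNReal.ofReal_ne_top, add_mul]
        refine (oscMeasure_le f τ ζ (measurableSet_box k r ζ)).trans ?_
        gcongr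
        exact haarTorus_box_le k hr1.1.le ζ
      calc (q ^ 2) ^ (∑ j, k j) *
          (oscMeasure f τ ζ (box k r ζ) / ENNReal.ofReal (boxSize k r))
          ≤ (q ^ (∑ j, k j) * q ^ (∑ j, k j)) * ((q ^ (∑ j, k j))⁻¹ + ‖f ζ‖ₑ) := by
            rw [hsq]; gcongr
        _ = (q ^ (∑ j, k j) * (q ^ (∑ j, k j))⁻¹) * q ^ (∑ j, k j) +
              q ^ (∑ j, k j) * (‖f ζ‖ₑ * q ^ (∑ j, k j)) := by ring
        _ ≤ 1 * q ^ (∑ j, k j) + 1 * (‖f ζ‖ₑ * q ^ (∑ j, k j)) := by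
            gcongr
            · rw [ENNReal.mul_inv_cancel hq0' hqt]
            · exact hqn _
        _ = _ := by ring
  have hmain := tendsto_lintegral_filter_of_dominated_convergence (μ := Measure.count)
    (l := 𝓝[>] (0 : ℝ)) (f := fun _ : Fin n → ℕ => (0 : ℝ≥0∞))
    (F := fun (r : ℝ) (k : Fin n → ℕ) => (q ^ 2) ^ (∑ j, k j) *
      (oscMeasure f τ ζ (box k r ζ) / ENNReal.ofReal (boxSize k r)))
    (fun k => (1 + ‖f ζ‖ₑ) * q ^ (∑ j, k j))
    (Eventually.of_forall fun _ => measurable_of_countable _)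
    (hbound.mono fun r hr => Eventually.of_forall hr)
    (by
      rw [lintegral_count, ENNReal.tsum_mul_left]
      exact ENNReal.mul_ne_top (by simp) (tsum_pow_sum_ne_top n hq))
    (Eventually.of_forall fun k => by
      have := ENNReal.Tendsto.const_mul (a := (q ^ 2) ^ (∑ j, k j)) (hlim k)
        (.inr (ENNReal.pow_ne_top (ENNReal.pow_ne_top hq.ne_top)))
      rwa [mul_zero] at this)
  simpa only [lintegral_count, lintegral_zero] using hmain

/-! ### Size of the kernel in Stolz regions -/

/-- The one-variable `(a, b)`-Poisson kernel. -/
def poissonFactor (a b w : ℂ) (ξ : Circle) : ℂ :=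
  coef a b * (((1 - ‖w‖ ^ 2 : ℝ) : ℂ) ^ (a + b + 1) /
      ((1 - w * conj (ξ : ℂ)) ^ (a + 1) * (1 - conj w * (ξ : ℂ)) ^ (b + 1)))

theorem abPoissonKernel_eq_prod {n : ℕ} (α β : Fin n → ℂ) (z : Fin n → ℂ) (ζ : Torus n) :
    abPoissonKernel α β z ζ = ∏ j, poissonFactor (α j) (β j) (z j) (ζ j) := rfl

theorem norm_one_sub_mul_conj (w : ℂ) (ξ : Circle) : ‖1 - w * conj (ξ : ℂ)‖ = ‖(ξ : ℂ) - w‖ := by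
  have h : (ξ : ℂ) - w = ξ * (1 - w * conj (ξ : ℂ)) := by
    rw [mul_sub, mul_left_comm, Complex.mul_conj, Circle.normSq_coe]; simp
  rw [h, norm_mul, Circle.norm_coe, one_mul]

theorem norm_one_sub_conj_mul (w : ℂ) (ξ : Circle) : ‖1 - conj w * (ξ : ℂ)‖ = ‖(ξ : ℂ) - w‖ := by
  rw [← norm_one_sub_mul_conj, ← Complex.norm_conj]; simp

/-- The imaginary part of the exponent costs only a bounded factor, since |arg z| ≤ π. -/
theorem norm_inv_cpow_le {z : ℂ} (hz : z ≠ 0) (s : ℂ) :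
    ‖(z ^ s)⁻¹‖ ≤ Real.exp (Real.pi * |s.im|) * ‖z‖ ^ (-s.re) := by
  rw [norm_inv, Complex.norm_cpow_of_ne_zero hz, inv_div, Real.rpow_neg (norm_nonneg _),
    div_eq_mul_inv]
  refine mul_le_mul_of_nonneg_right (Real.exp_le_exp.2 ?_) (by positivity)
  calc z.arg * s.im ≤ |z.arg * s.im| := le_abs_self _
    _ = |z.arg| * |s.im| := abs_mul _ _
    _ ≤ _ := by gcongr; exact Complex.abs_arg_le_pi z

theorem norm_poissonFactor_le (a b : ℂ) {w : ℂ} (hw : ‖w‖ < 1) (ξ : Circle) :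
    ‖poissonFactor a b w ξ‖ ≤
      ‖coef a b‖ * Real.exp (Real.pi * |(a + 1).im|) * Real.exp (Real.pi * |(b + 1).im|) *
        ((1 - ‖w‖ ^ 2) ^ (a.re + b.re + 1) * ‖(ξ : ℂ) - w‖ ^ (-(a.re + b.re + 2))) := by
  have hD : 0 < ‖(ξ : ℂ) - w‖ := by
    have := norm_sub_norm_le (ξ : ℂ) w
    rw [Circle.norm_coe] at this
    linarith
  have h1 : 1 - w * conj (ξ : ℂ) ≠ 0 := by
    rw [← norm_pos_iff, norm_one_sub_mul_conj]; exact hD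
  have h2 : 1 - conj w * (ξ : ℂ) ≠ 0 := by
    rw [← norm_pos_iff, norm_one_sub_conj_mul]; exact hD
  have h3 : 0 < 1 - ‖w‖ ^ 2 := by nlinarith [norm_nonneg w]
  have e1 := norm_inv_cpow_le h1 (a + 1)
  have e2 := norm_inv_cpow_le h2 (b + 1)
  rw [norm_one_sub_mul_conj] at e1
  rw [norm_one_sub_conj_mul] at e2
  have hpow : ‖(ξ : ℂ) - w‖ ^ (-(a.re + b.re + 2)) =
      ‖(ξ : ℂ) - w‖ ^ (-(a + 1).re) * ‖(ξ : ℂ) - w‖ ^ (-(b + 1).re) := by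
    rw [← Real.rpow_add hD]; congr 1; simp; ring
  rw [poissonFactor, norm_mul, div_eq_mul_inv, mul_inv, norm_mul, norm_mul,
    Complex.norm_cpow_eq_rpow_re_of_pos h3, hpow]
  have hre : (a + b + 1).re = a.re + b.re + 1 := by simp
  rw [hre]
  calc ‖coef a b‖ * ((1 - ‖w‖ ^ 2) ^ (a.re + b.re + 1) *
        (‖((1 - w * conj (ξ : ℂ)) ^ (a + 1))⁻¹‖ * ‖((1 - conj w * (ξ : ℂ)) ^ (b + 1))⁻¹‖))
      ≤ ‖coef a b‖ * ((1 - ‖w‖ ^ 2) ^ (a.re + b.re + 1) *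
        ((Real.exp (Real.pi * |(a + 1).im|) * ‖(ξ : ℂ) - w‖ ^ (-(a + 1).re)) *
          (Real.exp (Real.pi * |(b + 1).im|) * ‖(ξ : ℂ) - w‖ ^ (-(b + 1).re)))) := by gcongr
    _ = _ := by ring

theorem norm_lt_one_of_mem_stolz {A : ℝ} {ζ : Circle} {w : ℂ} (hw : w ∈ stolz A ζ) :
    ‖w‖ < 1 ∧ ‖(ζ : ℂ) - w‖ ≤ (A + 1) * (1 - ‖w‖) := by
  obtain ⟨r, θ, hr0, hr1, hθ, rfl⟩ := hw
  have he : Complex.exp (-(θ : ℂ) * Complex.I) = ((Circle.exp (-θ) : Circle) : ℂ) := by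
    rw [Circle.coe_exp]; push_cast; rfl
  have hn : ‖(r : ℂ) * ((ζ : ℂ) * Complex.exp (-(θ : ℂ) * Complex.I))‖ = r := by
    rw [he, norm_mul, norm_mul, Circle.norm_coe, Circle.norm_coe, Complex.norm_real,
      Real.norm_of_nonneg hr0]; ring
  rw [hn]
  refine ⟨hr1, ?_⟩
  have hd : ‖1 - Complex.exp (-(θ : ℂ) * Complex.I)‖ ≤ |θ| := by
    rw [← norm_neg, neg_sub, mul_comm, ← Complex.ofReal_neg,
      Complex.norm_exp_I_mul_ofReal_sub_one, norm_mul]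
    have := Real.abs_sin_le_abs (x := -θ / 2)
    rw [abs_div, abs_two, abs_neg] at this
    simp only [Real.norm_eq_abs, abs_two]
    linarith
  have hsplit : (ζ : ℂ) - (r : ℂ) * ((ζ : ℂ) * Complex.exp (-(θ : ℂ) * Complex.I)) =
      ζ * (((1 - r : ℝ) : ℂ) + r * (1 - Complex.exp (-(θ : ℂ) * Complex.I))) := by
    push_cast; ring
  rw [hsplit, norm_mul, Circle.norm_coe, one_mul]
  calc ‖((1 - r : ℝ) : ℂ) + r * (1 - Complex.exp (-(θ : ℂ) * Complex.I))‖
      ≤ ‖((1 - r : ℝ) : ℂ)‖ + ‖(r : ℂ) * (1 - Complex.exp (-(θ : ℂ) * Complex.I))‖ :=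
        norm_add_le _ _
    _ ≤ (1 - r) + 1 * |θ| := by
        rw [norm_mul, Complex.norm_real, Complex.norm_real, Real.norm_of_nonneg hr0,
          Real.norm_of_nonneg (by linarith)]
        gcongr
    _ ≤ (A + 1) * (1 - r) := by linarith

/-- Take the least k with t ≤ 2^k r: either k = 0, or minimality gives 2^{k-1} r < t. -/
theorem exists_dyadic_scale {r t : ℝ} (hr : 0 < r) (ht : 0 ≤ t) :
    ∃ k : ℕ, t ≤ 2 ^ k * r ∧ 2 ^ k * r ≤ 2 * (r + t) := by
  have hex : ∃ k : ℕ, t ≤ 2 ^ k * r := by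
    obtain ⟨k, hk⟩ := pow_unbounded_of_one_lt (t / r) one_lt_two
    exact ⟨k, ((div_lt_iff₀ hr).1 hk).le⟩
  classical
  refine ⟨Nat.find hex, Nat.find_spec hex, ?_⟩
  rcases h : Nat.find hex with _ | m
  · simp; linarith
  · have := Nat.find_min hex (m := m) (by omega)
    rw [pow_succ]
    linarith

/-- In a Stolz region, the kernel at scale `r` decays geometrically over dyadic arcs. -/
theorem exists_poissonFactor_dyadic_bound (a b : ℂ) {A B ε : ℝ} (hA : 0 < A) (hB : 1 ≤ B)
    (hε0 : 0 < ε) (hε : ε ≤ a.re + b.re + 1) :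
    ∃ C : ℝ, 0 ≤ C ∧ ∀ (r : ℝ) (ζ : Circle) (w : ℂ), 0 < r → w ∈ stolz A ζ →
      r ≤ B * (1 - ‖w‖) → 1 - ‖w‖ ≤ B * r → ∀ ξ : Circle, ∃ k : ℕ,
        ξ ∈ closedBall ζ (2 ^ k * r) ∧
        ‖poissonFactor a b w ξ‖ ≤ C * (((2 : ℝ) ^ (-ε)) ^ k / (2 ^ k * r)) := by
  set c := a.re + b.re + 1 with hc
  have hc0 : 0 < c := hε0.trans_le hε
  set C₀ := ‖coef a b‖ * Real.exp (Real.pi * |(a + 1).im|) * Real.exp (Real.pi * |(b + 1).im|)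
    with hC₀
  -- With D = |ξ - w|, the cone conditions give r ≤ B D and t ≤ (A + 2) D, so 2 (r + t) ≤ 2 B (A +
  -- 3) D because B ≥ 1.
  set M := 2 * (B * (A + 3)) with hM
  have hM0 : 0 < M := by positivity
  refine ⟨C₀ * ((2 * B) ^ c * M ^ (c + 1)), by positivity, ?_⟩
  intro r ζ w hr hw h1 h2 ξ
  obtain ⟨hw1, hwζ⟩ := norm_lt_one_of_mem_stolz hw
  set t := dist ξ ζ with ht
  have ht' : t = ‖(ξ : ℂ) - ζ‖ := dist_eq_norm (ξ : ℂ) (ζ : ℂ)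
  obtain ⟨k, hk1, hk2⟩ := exists_dyadic_scale hr (dist_nonneg : 0 ≤ t)
  refine ⟨k, hk1, ?_⟩
  have hkr : 0 < 2 ^ k * r := by positivity
  have hD1 : 1 - ‖w‖ ≤ ‖(ξ : ℂ) - w‖ := by
    have := norm_sub_norm_le (ξ : ℂ) w
    rwa [Circle.norm_coe] at this
  have hD2 : t ≤ ‖(ξ : ℂ) - w‖ + ‖(ζ : ℂ) - w‖ := by
    rw [ht']
    have := norm_sub_le ((ξ : ℂ) - w) ((ζ : ℂ) - w)
    rwa [sub_sub_sub_cancel_right] at this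
  have hD : 2 ^ k * r ≤ M * ‖(ξ : ℂ) - w‖ := by
    have e1 : r ≤ B * ‖(ξ : ℂ) - w‖ := h1.trans (by gcongr)
    have e2 : t ≤ (A + 2) * ‖(ξ : ℂ) - w‖ := by nlinarith
    have e3 : (A + 2) * ‖(ξ : ℂ) - w‖ ≤ B * ((A + 2) * ‖(ξ : ℂ) - w‖) :=
      le_mul_of_one_le_left (by positivity) hB
    rw [hM]
    linarith
  have hDpos : 0 < ‖(ξ : ℂ) - w‖ := by linarith
  have hpow1 : (1 - ‖w‖ ^ 2) ^ c ≤ (2 * B) ^ c * r ^ c := by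
    rw [← Real.mul_rpow (by positivity) hr.le]
    apply Real.rpow_le_rpow _ _ hc0.le <;> nlinarith [norm_nonneg w]
  have hpow2 : ‖(ξ : ℂ) - w‖ ^ (-(c + 1)) ≤ M ^ (c + 1) * (2 ^ k * r) ^ (-(c + 1)) := by
    have e : (2 ^ k * r) / M ≤ ‖(ξ : ℂ) - w‖ := by rwa [div_le_iff₀' hM0]
    calc ‖(ξ : ℂ) - w‖ ^ (-(c + 1)) ≤ ((2 ^ k * r) / M) ^ (-(c + 1)) :=
          Real.rpow_le_rpow_of_nonpos (by positivity) e (by linarith)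
      _ = _ := by
          rw [Real.div_rpow hkr.le hM0.le, Real.rpow_neg hM0.le, div_inv_eq_mul, mul_comm]
  -- The powers of r cancel, leaving 2^{-ck}; it is weakened to 2^{-εk} so that all coordinates
  -- share one decay rate.
  have hscale : r ^ c * (2 ^ k * r) ^ (-(c + 1)) ≤ ((2 : ℝ) ^ (-ε)) ^ k / (2 ^ k * r) := by
    have e1 : (2 ^ k * r) ^ (-(c + 1)) = (2 ^ k * r) ^ (-c) / (2 ^ k * r) := by
      rw [neg_add, ← sub_eq_add_neg, Real.rpow_sub hkr, Real.rpow_one]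
    have e2 : (2 ^ k * r) ^ (-c) = ((2 : ℝ) ^ (-c)) ^ k * r ^ (-c) := by
      rw [Real.mul_rpow (by positivity) hr.le, ← Real.rpow_natCast, ← Real.rpow_mul (by norm_num),
        ← Real.rpow_natCast, ← Real.rpow_mul (by norm_num), mul_comm (k : ℝ)]
    have e3 : r ^ c * r ^ (-c) = 1 := by
      rw [← Real.rpow_add hr, add_neg_cancel, Real.rpow_zero]
    rw [e1, e2, mul_div_assoc', mul_left_comm, e3, mul_one]
    gcongr
    exact one_le_two
  have hexp : a.re + b.re + 2 = c + 1 := by rw [hc]; ring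
  calc ‖poissonFactor a b w ξ‖ ≤ C₀ * ((1 - ‖w‖ ^ 2) ^ c * ‖(ξ : ℂ) - w‖ ^ (-(c + 1))) := by
        have := norm_poissonFactor_le a b hw1 ξ
        rwa [hexp] at this
    _ ≤ C₀ * (((2 * B) ^ c * r ^ c) * (M ^ (c + 1) * (2 ^ k * r) ^ (-(c + 1)))) := by gcongr
    _ = C₀ * ((2 * B) ^ c * M ^ (c + 1)) * (r ^ c * (2 ^ k * r) ^ (-(c + 1))) := by ring
    _ ≤ _ := by gcongr

/-- The kernel in a restricted Stolz region is dominated by weighted averages over boxes. -/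
theorem exists_lintegral_kernel_le {n : ℕ} (α β : Fin n → ℂ) {A B ε : ℝ} (hA : 0 < A)
    (hB : 1 ≤ B) (hε0 : 0 < ε) (hε : ∀ j, ε ≤ (α j).re + (β j).re + 1) :
    ∃ C : ℝ≥0∞, C ≠ ∞ ∧ ∀ (r : ℝ) (ζ : Torus n) (z : Fin n → ℂ), 0 < r →
      (∀ j, z j ∈ stolz A (ζ j)) → (∀ j, r ≤ B * (1 - ‖z j‖)) → (∀ j, 1 - ‖z j‖ ≤ B * r) →
      ∀ ρ : Measure (Torus n), ∫⁻ η, ‖abPoissonKernel α β z η‖ₑ ∂ρ ≤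
        C * ∑' k : Fin n → ℕ, ENNReal.ofReal ((2 : ℝ) ^ (-ε)) ^ (∑ j, k j) *
          (ρ (box k r ζ) / ENNReal.ofReal (boxSize k r)) := by
  choose C hC0 hC using fun j =>
    exists_poissonFactor_dyadic_bound (α j) (β j) hA hB hε0 (hε j)
  refine ⟨ENNReal.ofReal (∏ j, C j), ENNReal.ofReal_ne_top, ?_⟩
  intro r ζ z hr hz h1 h2 ρ
  have hp0 : (0 : ℝ) ≤ 2 ^ (-ε) := by positivity
  have hpt : ∀ η : Torus n, ‖abPoissonKernel α β z η‖ₑ ≤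
      ENNReal.ofReal (∏ j, C j) * ∑' k : Fin n → ℕ,
        ENNReal.ofReal ((2 : ℝ) ^ (-ε)) ^ (∑ j, k j) *
          ((box k r ζ).indicator 1 η / ENNReal.ofReal (boxSize k r)) := by
    intro η
    -- Each η needs only one box, the one at its own dyadic distances; that single term is at most
    -- the whole sum.
    choose k hk1 hk2 using fun j => hC j r (ζ j) (z j) hr (hz j) (h1 j) (h2 j) (η j)
    have hmem : η ∈ box k r ζ := fun j _ => hk1 j
    have hnorm : ‖abPoissonKernel α β z η‖ ≤
        (∏ j, C j) * (((2 : ℝ) ^ (-ε)) ^ (∑ j, k j) / boxSize k r) := by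
      rw [abPoissonKernel_eq_prod, norm_prod]
      refine (Finset.prod_le_prod (fun _ _ => norm_nonneg _) fun j _ => hk2 j).trans_eq ?_
      rw [Finset.prod_mul_distrib, Finset.prod_div_distrib, Finset.prod_pow_eq_pow_sum, boxSize]
    rw [← ofReal_norm]
    refine (ENNReal.ofReal_le_ofReal hnorm).trans ?_
    rw [ENNReal.ofReal_mul (Finset.prod_nonneg fun j _ => hC0 j)]
    gcongr
    refine le_trans ?_ (ENNReal.le_tsum k)
    rw [indicator_of_mem hmem, Pi.one_apply, ENNReal.ofReal_div_of_pos (boxSize_pos k hr),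
      ENNReal.ofReal_pow hp0, div_eq_mul_inv, one_div]
  have hmeas : ∀ k : Fin n → ℕ, Measurable fun η : Torus n =>
      (box k r ζ).indicator (1 : Torus n → ℝ≥0∞) η / ENNReal.ofReal (boxSize k r) := fun k =>
    (measurable_one.indicator (measurableSet_box k r ζ)).div_const _
  refine (lintegral_mono hpt).trans_eq ?_
  rw [lintegral_const_mul _ (Measurable.tsum fun k => (hmeas k).const_mul _),
    lintegral_tsum fun k => ((hmeas k).const_mul _).aemeasurable]
  congr 1
  refine tsum_congr fun k => ?_
  rw [lintegral_const_mul _ (hmeas k)]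
  simp only [div_eq_mul_inv]
  rw [lintegral_mul_const _ (measurable_one.indicator (measurableSet_box k r ζ)),
    lintegral_indicator_one (measurableSet_box k r ζ)]

/-! ### Total mass of the kernel: binomial series and an Abelian theorem -/

/-- The coefficient `s (s+1) ⋯ (s+n-1) / n!` of `yⁿ` in `(1 - y)^{-s}`. -/
def risingCoeff (s : ℂ) (n : ℕ) : ℂ := (∏ j ∈ Finset.range n, (s + j)) / n.factorial

theorem multichoose_eq_risingCoeff (s : ℂ) (n : ℕ) : Ring.multichoose s n = risingCoeff s n := by
  have h := Ring.factorial_nsmul_multichoose_eq_ascPochhammer s n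
  have hp : (ascPochhammer ℕ n).smeval s = ∏ j ∈ Finset.range n, (s + j) := by
    induction n with
    | zero => simp
    | succ n ih =>
      rw [ascPochhammer_succ_right, Polynomial.smeval_mul,
        ih (Ring.factorial_nsmul_multichoose_eq_ascPochhammer s n),
        Finset.prod_range_succ]
      simp [Polynomial.smeval_natCast]
  rw [hp, nsmul_eq_mul] at h
  rw [risingCoeff, eq_div_iff (by exact_mod_cast n.factorial_ne_zero), mul_comm, h]

theorem hasSum_risingCoeff (s : ℂ) {y : ℂ} (hy : ‖y‖ < 1) :
    HasSum (fun n => risingCoeff s n * y ^ n) (((1 - y) ^ s)⁻¹) := by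
  have h := (Complex.one_div_one_sub_cpow_hasFPowerSeriesOnBall_zero s).hasSum (y := y) (by
    rw [mem_eball, edist_zero_right, ← ofReal_norm, ENNReal.ofReal_lt_one]
    exact hy)
  simp only [zero_add, one_div] at h
  refine h.congr_fun ?_
  intro n
  simp [← Ring.multichoose_eq, multichoose_eq_risingCoeff, mul_comm]

/-- This is the reciprocal of Euler's limit for Γ(s). `Complex.GammaSeq` has n + 1 factors in its
denominator, one more than the coefficient, whence the correction n / (n + s) → 1. -/
theorem tendsto_risingCoeff_mul {s : ℂ} (hs : ∀ m : ℕ, s ≠ -m) :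
    Tendsto (fun n : ℕ => risingCoeff s n * (n : ℂ) ^ (1 - s)) atTop
      (𝓝 (Complex.Gamma s)⁻¹) := by
  have h := (tendsto_natCast_div_add_atTop s).mul
    ((Complex.GammaSeq_tendsto_Gamma s).inv₀ (Complex.Gamma_ne_zero hs))
  rw [one_mul] at h
  refine h.congr' ?_
  filter_upwards [eventually_ne_atTop 0] with n hn
  have hn' : (n : ℂ) ≠ 0 := by exact_mod_cast hn
  have hsn : s + n ≠ 0 := fun h0 => hs n (eq_neg_of_add_eq_zero_left h0)
  have hf : (n.factorial : ℂ) ≠ 0 := by exact_mod_cast n.factorial_ne_zero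
  have hpow : (n : ℂ) ^ s ≠ 0 := by simp [Complex.cpow_eq_zero_iff, hn']
  rw [Complex.GammaSeq, Finset.prod_range_succ, risingCoeff, Complex.cpow_sub _ _ hn',
    Complex.cpow_one, inv_div, add_comm (n : ℂ) s]
  field_simp

/-- For k ≠ l, rotation by exp(iπ / (l - k)) changes the sign of the integrand, so invariance makes
the integral its own negative. -/
theorem integral_conj_pow_mul_pow (k l : ℕ) :
    ∫ ξ : Circle, conj (ξ : ℂ) ^ k * (ξ : ℂ) ^ l ∂haarCircle = if k = l then 1 else 0 := by
  split_ifs with h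
  · subst h
    have : ∀ ξ : Circle, conj (ξ : ℂ) ^ k * (ξ : ℂ) ^ k = 1 := fun ξ => by
      rw [← mul_pow, mul_comm, Complex.mul_conj, Circle.normSq_coe]; simp
    simp [this]
  · set m : ℝ := (l : ℝ) - k with hm
    have hm0 : m ≠ 0 := sub_ne_zero.2 fun h' => h (by exact_mod_cast h'.symm)
    set g : Circle := Circle.exp (Real.pi / m)
    have hg : conj (g : ℂ) ^ k * (g : ℂ) ^ l = -1 := by
      have hmc : ((l : ℂ) - k) * ((Real.pi / m : ℝ) : ℂ) = Real.pi := by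
        have h1 : (l : ℂ) - k = (m : ℂ) := by rw [hm]; push_cast; rfl
        rw [h1, ← Complex.ofReal_mul, mul_div_cancel₀ _ hm0]
      rw [Circle.coe_exp, ← Complex.exp_conj, ← Complex.exp_nat_mul, ← Complex.exp_nat_mul,
        ← Complex.exp_add, ← Complex.exp_pi_mul_I, ← hmc]
      congr 1
      rw [map_mul, Complex.conj_I, Complex.conj_ofReal]
      ring
    have hinv := integral_mul_left_eq_self (μ := haarCircle)
      (fun ξ : Circle => conj (ξ : ℂ) ^ k * (ξ : ℂ) ^ l) g
    have heq : ∀ ξ : Circle, conj ((g * ξ : Circle) : ℂ) ^ k * ((g * ξ : Circle) : ℂ) ^ l =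
        -(conj (ξ : ℂ) ^ k * (ξ : ℂ) ^ l) := fun ξ => by
      rw [Circle.coe_mul, map_mul, mul_pow, mul_pow, mul_mul_mul_comm, hg, neg_one_mul]
    simp only [heq, integral_neg] at hinv
    have := self_eq_neg.1 hinv.symm
    exact this

/-- Parseval: absolute convergence permits termwise integration of the double series, and
orthogonality keeps the diagonal. -/
theorem hasSum_integral_mul_diagonal {A B : ℕ → ℂ} (hA : Summable fun k => ‖A k‖)
    (hB : Summable fun k => ‖B k‖) :
    HasSum (fun k => A k * B k)
      (∫ ξ : Circle, (∑' k, A k * conj (ξ : ℂ) ^ k) * (∑' l, B l * (ξ : ℂ) ^ l)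
        ∂haarCircle) := by
  have hAB : Summable fun p : ℕ × ℕ => ‖A p.1‖ * ‖B p.2‖ :=
    hA.mul_of_nonneg hB (fun _ => norm_nonneg _) fun _ => norm_nonneg _
  set F : ℕ × ℕ → Circle → ℂ := fun p ξ =>
    (A p.1 * conj (ξ : ℂ) ^ p.1) * (B p.2 * (ξ : ℂ) ^ p.2) with hF
  have hFn : ∀ p ξ, ‖F p ξ‖ = ‖A p.1‖ * ‖B p.2‖ := fun p ξ => by
    simp [hF, Circle.norm_coe]
  have hcont : ∀ p, Continuous (F p) := fun p => by
    have h1 : Continuous fun ξ : Circle => (ξ : ℂ) := continuous_subtype_val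
    have h2 := Complex.continuous_conj.comp h1
    simp only [Function.comp_def] at h2
    fun_prop
  have hint : ∀ p, Integrable (F p) haarCircle := fun p =>
    (hcont p).integrable_of_hasCompactSupport (HasCompactSupport.of_compactSpace _)
  have hsum := hasSum_integral_of_summable_integral_norm hint (by simpa [hFn] using hAB)
  have htsum : ∀ ξ : Circle, ∑' p, F p ξ =
      (∑' k, A k * conj (ξ : ℂ) ^ k) * (∑' l, B l * (ξ : ℂ) ^ l) := fun ξ =>
    (tsum_mul_tsum_of_summable_norm (f := fun k => A k * conj (ξ : ℂ) ^ k)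
      (g := fun l => B l * (ξ : ℂ) ^ l) (by simpa [Circle.norm_coe] using hA)
      (by simpa [Circle.norm_coe] using hB)).symm
  simp only [htsum] at hsum
  have hval : ∀ p : ℕ × ℕ, ∫ ξ, F p ξ ∂haarCircle =
      A p.1 * B p.2 * if p.1 = p.2 then 1 else 0 := fun p => by
    rw [← integral_conj_pow_mul_pow, ← integral_const_mul]
    congr 1; ext ξ; simp only [hF]; ring
  simp only [hval] at hsum
  have hinj : Function.Injective fun k : ℕ => (k, k) := fun a b h => (Prod.ext_iff.1 h).1
  rw [← hinj.hasSum_iff] at hsum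
  · simpa [Function.comp_def] using hsum
  · rintro ⟨k, l⟩ hkl
    have : k ≠ l := fun h => hkl ⟨k, by simp [h]⟩
    simp [this]

/-- The circular mean of the one-variable kernel as a power series in `‖w‖²`. -/
theorem integral_poissonFactor (a b : ℂ) {w : ℂ} (hw : ‖w‖ < 1) :
    ∫ ξ, poissonFactor a b w ξ ∂haarCircle =
      coef a b * (((1 - ‖w‖ ^ 2 : ℝ) : ℂ) ^ (a + b + 1) *
        ∑' k, risingCoeff (a + 1) k * risingCoeff (b + 1) k * ((‖w‖ ^ 2 : ℝ) : ℂ) ^ k) := by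
  have hw' : ‖conj w‖ < 1 := by simpa using hw
  have hA := (hasSum_risingCoeff (a + 1) hw).summable.norm
  have hB := (hasSum_risingCoeff (b + 1) hw').summable.norm
  have hpt : ∀ ξ : Circle, poissonFactor a b w ξ =
      coef a b * ((1 - ‖w‖ ^ 2 : ℝ) : ℂ) ^ (a + b + 1) *
      ((∑' k, (risingCoeff (a + 1) k * w ^ k) * conj (ξ : ℂ) ^ k) *
        ∑' l, (risingCoeff (b + 1) l * conj w ^ l) * (ξ : ℂ) ^ l) := fun ξ => by
    have h1 := (hasSum_risingCoeff (a + 1) (y := w * conj (ξ : ℂ))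
      (by simpa [Circle.norm_coe] using hw)).tsum_eq
    have h2 := (hasSum_risingCoeff (b + 1) (y := conj w * (ξ : ℂ))
      (by simpa [Circle.norm_coe] using hw)).tsum_eq
    simp only [mul_assoc, ← mul_pow]
    rw [h1, h2, poissonFactor, div_eq_mul_inv, mul_inv]
  simp only [hpt]
  rw [integral_const_mul, ← (hasSum_integral_mul_diagonal hA hB).tsum_eq, mul_assoc]
  congr 2
  refine tsum_congr fun k => ?_
  have : ((‖w‖ ^ 2 : ℝ) : ℂ) = w * conj w := by
    rw [Complex.mul_conj, Complex.normSq_eq_norm_sq]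
  rw [this, mul_pow]
  ring

theorem hasSum_norm_risingCoeff {t ρ : ℝ} (ht : 0 < t) (h0 : 0 ≤ ρ) (h1 : ρ < 1) :
    HasSum (fun n => ‖risingCoeff t n‖ * ρ ^ n) ((1 - ρ) ^ (-t)) := by
  have h := hasSum_risingCoeff (t : ℂ) (y := (ρ : ℂ)) (by
    rw [Complex.norm_real, Real.norm_of_nonneg h0]; exact h1)
  rw [← Complex.hasSum_ofReal]
  have hc : ∀ n, ((‖risingCoeff t n‖ : ℝ) : ℂ) = risingCoeff t n := fun n => by
    have : risingCoeff t n = (((∏ j ∈ Finset.range n, (t + j)) / n.factorial : ℝ) : ℂ) := by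
      simp [risingCoeff]
    rw [this, Complex.norm_real, Real.norm_of_nonneg]
    exact div_nonneg (Finset.prod_nonneg fun j _ => by positivity) (by positivity)
  have hv : (((1 - ρ) ^ (-t) : ℝ) : ℂ) = ((1 - (ρ : ℂ)) ^ (t : ℂ))⁻¹ := by
    rw [Real.rpow_neg (by linarith), Complex.ofReal_inv, Complex.ofReal_cpow (by linarith)]
    simp
  rw [hv]
  refine h.congr_fun fun n => ?_
  simp [hc]

/-- An Abelian theorem: coefficients that are negligible with respect to `V` give a sum that is
negligible with respect to `(1 - ρ)^{-t}`. -/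
theorem tendsto_rpow_mul_tsum_zero {t : ℝ} (ht : 0 < t) {V : ℕ → ℝ} {d : ℕ → ℂ}
    (hV : ∀ ρ : ℝ, 0 ≤ ρ → ρ < 1 → HasSum (fun n => V n * ρ ^ n) ((1 - ρ) ^ (-t)))
    (hV0 : ∀ n, 0 ≤ V n) (hd : d =o[atTop] V) :
    Tendsto (fun ρ : ℝ => (1 - ρ) ^ t * ‖∑' n, d n * (ρ : ℂ) ^ n‖) (𝓝[<] 1) (𝓝 0) := by
  rw [tendsto_order]
  refine ⟨fun x hx => ?_, fun ε hε => ?_⟩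
  · filter_upwards [Ioo_mem_nhdsLT (zero_lt_one' ℝ)] with ρ hρ
    have : 0 < 1 - ρ := by linarith [hρ.2]
    exact hx.trans_le (by positivity)
  -- Beyond N the coefficients are at most (ε/2) V n; the finite head is killed by (1 - ρ)^t.
  obtain ⟨N, hN⟩ := eventually_atTop.1 (hd.def (half_pos hε))
  set S := ∑ n ∈ Finset.range N, ‖d n‖ with hS
  have hlim : Tendsto (fun ρ : ℝ => (1 - ρ) ^ t * S) (𝓝[<] 1) (𝓝 0) := by
    have hc : ContinuousAt (fun ρ : ℝ => (1 - ρ) ^ t * S) 1 := by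
      refine ContinuousAt.mul ?_ continuousAt_const
      exact ContinuousAt.rpow_const (by fun_prop) (.inr ht.le)
    have h := hc.tendsto
    simp only [sub_self, Real.zero_rpow ht.ne', zero_mul] at h
    exact h.mono_left nhdsWithin_le_nhds
  filter_upwards [Ioo_mem_nhdsLT (zero_lt_one' ℝ), hlim.eventually_lt_const (half_pos hε)]
    with ρ hρ hS'
  have h1ρ : 0 < 1 - ρ := by linarith [hρ.2]
  have hsV := hV ρ hρ.1.le hρ.2
  have hterm : ∀ n, ‖d n * (ρ : ℂ) ^ n‖ = ‖d n‖ * ρ ^ n := fun n => by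
    rw [norm_mul, norm_pow, Complex.norm_real, Real.norm_of_nonneg hρ.1.le]
  have hle : ∀ n, ‖d n * (ρ : ℂ) ^ n‖ ≤
      (if n < N then ‖d n‖ else 0) + ε / 2 * (V n * ρ ^ n) := by
    intro n
    have hp : 0 ≤ ρ ^ n := pow_nonneg hρ.1.le n
    have hp1 : ρ ^ n ≤ 1 := pow_le_one₀ hρ.1.le hρ.2.le
    have hv := hV0 n
    rw [hterm]
    split_ifs with h
    · have : ‖d n‖ * ρ ^ n ≤ ‖d n‖ * 1 := by gcongr
      have : 0 ≤ ε / 2 * (V n * ρ ^ n) := by positivity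
      linarith
    · have h2 := hN n (not_lt.1 h)
      rw [Real.norm_of_nonneg hv] at h2
      rw [zero_add, ← mul_assoc]
      gcongr
  have hsum1 : HasSum (fun n => if n < N then ‖d n‖ else 0) S := by
    have : HasSum _ _ := hasSum_sum_of_ne_finset_zero (L := .unconditional ℕ)
      (f := fun n => if n < N then ‖d n‖ else 0) (s := Finset.range N)
      (fun n hn => if_neg fun h => hn (Finset.mem_range.2 h))
    convert this using 1
    exact Finset.sum_congr rfl fun n hn => by simp [Finset.mem_range.1 hn]
  have hb := tsum_of_norm_bounded (hsum1.add (hsV.mul_left (ε / 2))) hle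
  calc (1 - ρ) ^ t * ‖∑' n, d n * (ρ : ℂ) ^ n‖
      ≤ (1 - ρ) ^ t * (S + ε / 2 * (1 - ρ) ^ (-t)) := by gcongr
    _ = (1 - ρ) ^ t * S + ε / 2 * ((1 - ρ) ^ t * (1 - ρ) ^ (-t)) := by ring
    _ = (1 - ρ) ^ t * S + ε / 2 := by
        rw [← Real.rpow_add h1ρ, add_neg_cancel, Real.rpow_zero, mul_one]
    _ < ε := by linarith

/-- With c = a + b - 1, both terms are asymptotic to n^{c-1} / (Γ(a) Γ(b)); the factor Γ(c) is there
to match the constants. The comparison sequence uses Re c because only the modulus n^{Re c - 1}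
matters, and its terms are positive. -/
theorem isLittleO_risingCoeff {a b : ℂ} (ha : ∀ m : ℕ, a ≠ -m) (hb : ∀ m : ℕ, b ≠ -m)
    (hc : 0 < (a + b - 1).re) :
    (fun n => risingCoeff a n * risingCoeff b n -
      Complex.Gamma (a + b - 1) / (Complex.Gamma a * Complex.Gamma b) *
        risingCoeff (a + b - 1) n) =o[atTop]
      fun n => ‖risingCoeff (((a + b - 1).re : ℝ) : ℂ) n‖ := by
  set c := a + b - 1 with hcdef
  have hne : ∀ {s : ℂ}, 0 < s.re → ∀ m : ℕ, s ≠ -m := by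
    intro s hs m h
    rw [h] at hs
    simp at hs
    have : (0 : ℝ) ≤ m := by positivity
    linarith
  have hcr : 0 < ((c.re : ℝ) : ℂ).re := by simpa using hc
  have h1 := (tendsto_risingCoeff_mul ha).mul (tendsto_risingCoeff_mul hb)
  have h2 := (tendsto_risingCoeff_mul (hne hc)).const_mul
    (Complex.Gamma c / (Complex.Gamma a * Complex.Gamma b))
  have h3 := (tendsto_risingCoeff_mul (hne hcr)).norm
  have hG := Complex.Gamma_ne_zero (hne hc)
  have hGr := Complex.Gamma_ne_zero (hne hcr)
  have h4 := ((h1.sub h2).norm).div h3 (by simpa using hGr)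
  have hz : (Complex.Gamma a)⁻¹ * (Complex.Gamma b)⁻¹ -
      Complex.Gamma c / (Complex.Gamma a * Complex.Gamma b) * (Complex.Gamma c)⁻¹ = 0 := by
    rw [div_mul_eq_mul_div, mul_inv_cancel₀ hG, one_div, mul_inv, sub_self]
  rw [hz, norm_zero, zero_div] at h4
  have hVne : ∀ n, ‖risingCoeff ((c.re : ℝ) : ℂ) n‖ ≠ 0 := fun n => by
    rw [norm_ne_zero_iff, risingCoeff]
    refine div_ne_zero (Finset.prod_ne_zero_iff.2 fun j _ h0 => ?_)
      (by exact_mod_cast n.factorial_ne_zero)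
    exact hne hcr j (eq_neg_of_add_eq_zero_left h0)
  rw [← Asymptotics.isLittleO_norm_left,
    Asymptotics.isLittleO_iff_tendsto fun n h => absurd h (hVne n)]
  refine h4.congr' ?_
  filter_upwards [eventually_gt_atTop 0] with n hn
  have hn' : (n : ℂ) ≠ 0 := by exact_mod_cast hn.ne'
  have hnr : (0 : ℝ) < n := by exact_mod_cast hn
  have hpow : (n : ℂ) ^ (1 - a) * (n : ℂ) ^ (1 - b) = (n : ℂ) ^ (1 - c) := by
    rw [← Complex.cpow_add _ _ hn']; congr 1; rw [hcdef]; ring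
  have hnorm : ‖(n : ℂ) ^ (1 - c)‖ = ‖(n : ℂ) ^ (1 - ((c.re : ℝ) : ℂ))‖ := by
    rw [← Complex.ofReal_natCast, Complex.norm_cpow_eq_rpow_re_of_pos hnr,
      Complex.norm_cpow_eq_rpow_re_of_pos hnr]
    simp
  have hpos : ‖(n : ℂ) ^ (1 - ((c.re : ℝ) : ℂ))‖ ≠ 0 := by
    simp [Complex.cpow_eq_zero_iff, hn']
  have hfac : risingCoeff a n * (n : ℂ) ^ (1 - a) * (risingCoeff b n * (n : ℂ) ^ (1 - b)) -
      Complex.Gamma c / (Complex.Gamma a * Complex.Gamma b) *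
        (risingCoeff c n * (n : ℂ) ^ (1 - c)) =
      (risingCoeff a n * risingCoeff b n -
        Complex.Gamma c / (Complex.Gamma a * Complex.Gamma b) * risingCoeff c n) *
        (n : ℂ) ^ (1 - c) := by
    rw [← hpow]; ring
  simp only [Pi.div_apply]
  rw [hfac, norm_mul, norm_mul, hnorm, mul_div_mul_right _ _ hpos]

/-- The leading part of the series sums to L (1 - ρ)^{-(a+b+1)} and contributes exactly `coef a b *
L = 1`; the remainder vanishes by the Abelian theorem. This gives the boundary behaviour of ₂F₁(a+1,
b+1; 1; ρ). -/
theorem tendsto_poissonFactor_series {a b : ℂ} (hab : -1 < a.re + b.re)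
    (ha : ∀ k : ℕ, a ≠ -((k : ℂ) + 1)) (hb : ∀ k : ℕ, b ≠ -((k : ℂ) + 1)) :
    Tendsto (fun ρ : ℝ => coef a b * (((1 - ρ : ℝ) : ℂ) ^ (a + b + 1) *
        ∑' k, risingCoeff (a + 1) k * risingCoeff (b + 1) k * (ρ : ℂ) ^ k)) (𝓝[<] 1) (𝓝 1) := by
  have ha' : ∀ m : ℕ, a + 1 ≠ -m := fun m h => ha m (by linear_combination h)
  have hb' : ∀ m : ℕ, b + 1 ≠ -m := fun m h => hb m (by linear_combination h)
  have hc : a + 1 + (b + 1) - 1 = a + b + 1 := by ring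
  have hcre : 0 < (a + b + 1).re := by simp; linarith
  have hlo := isLittleO_risingCoeff ha' hb' (by rw [hc]; exact hcre)
  rw [hc] at hlo
  set L := Complex.Gamma (a + b + 1) / (Complex.Gamma (a + 1) * Complex.Gamma (b + 1)) with hL
  set c := a + b + 1 with hcdef
  set d : ℕ → ℂ := fun n => risingCoeff (a + 1) n * risingCoeff (b + 1) n - L * risingCoeff c n
    with hd
  have hcne : ∀ m : ℕ, c ≠ -m := by
    intro m h
    rw [h] at hcre
    simp at hcre
    have : (0 : ℝ) ≤ m := by positivity
    linarith
  have hcoefL : coef a b * L = 1 := by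
    have h1 := Complex.Gamma_ne_zero ha'
    have h2 := Complex.Gamma_ne_zero hb'
    have h3 := Complex.Gamma_ne_zero hcne
    rw [coef, hL, ← hcdef]
    field_simp
  have hlim := tendsto_rpow_mul_tsum_zero hcre
    (fun ρ h0 h1 => hasSum_norm_risingCoeff hcre h0 h1) (fun n => norm_nonneg _) hlo
  have hlim' : Tendsto (fun ρ : ℝ => coef a b * (((1 - ρ : ℝ) : ℂ) ^ c *
      ∑' n, d n * (ρ : ℂ) ^ n)) (𝓝[<] 1) (𝓝 0) := by
    have h0 : Tendsto (fun ρ : ℝ => ((1 - ρ : ℝ) : ℂ) ^ c *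
      ∑' n, d n * (ρ : ℂ) ^ n) (𝓝[<] 1) (𝓝 0) := by
      rw [tendsto_zero_iff_norm_tendsto_zero]
      refine hlim.congr' ?_
      filter_upwards [self_mem_nhdsWithin] with ρ hρ
      rw [norm_mul, Complex.norm_cpow_eq_rpow_re_of_pos (sub_pos.2 hρ)]
    simpa using h0.const_mul (coef a b)
  have hfin := hlim'.add (tendsto_const_nhds (x := (1 : ℂ)))
  rw [zero_add] at hfin
  refine hfin.congr' ?_
  filter_upwards [Ioo_mem_nhdsLT (zero_lt_one' ℝ)] with ρ hρ
  have hρn : ‖(ρ : ℂ)‖ < 1 := by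
    rw [Complex.norm_real, Real.norm_of_nonneg hρ.1.le]; exact hρ.2
  have hsc := hasSum_risingCoeff c hρn
  have hVs := (hasSum_norm_risingCoeff hcre hρ.1.le hρ.2).summable
  have hds : Summable fun n => d n * (ρ : ℂ) ^ n := by
    refine summable_of_isBigO_nat hVs ?_
    have hmul := hlo.isBigO.mul
      (Asymptotics.isBigO_of_le atTop (f := fun n : ℕ => (ρ : ℂ) ^ n) (g := fun n : ℕ => ρ ^ n)
        fun n => by simp)
    exact hmul
  have hsplit : ∑' n, risingCoeff (a + 1) n * risingCoeff (b + 1) n * (ρ : ℂ) ^ n =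
      ∑' n, d n * (ρ : ℂ) ^ n + L * ((1 - (ρ : ℂ)) ^ c)⁻¹ := by
    rw [← hsc.tsum_eq, ← tsum_mul_left, ← hds.tsum_add (hsc.summable.mul_left L)]
    refine tsum_congr fun n => ?_
    simp only [hd]; ring
  have hne : ((1 - ρ : ℝ) : ℂ) ^ c ≠ 0 := by
    have : ((1 - ρ : ℝ) : ℂ) ≠ 0 := by exact_mod_cast (sub_pos.2 hρ.2).ne'
    exact fun h => this ((Complex.cpow_eq_zero_iff _ _).1 h).1
  have hcast : ((1 - ρ : ℝ) : ℂ) = 1 - (ρ : ℂ) := by push_cast; ring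
  rw [hsplit, mul_add, mul_add, ← hcast, mul_left_comm _ L, mul_inv_cancel₀ hne, mul_one, hcoefL]

/-! ### Complex measures and the splitting of the Poisson integral -/

instance instIsFiniteMeasureComplexVariation {X : Type*} [MeasurableSpace X]
    (c : ComplexMeasure X) : IsFiniteMeasure c.variation := by
  have hle : c.variation ≤
      (ComplexMeasure.re c).totalVariation + (ComplexMeasure.im c).totalVariation := by
    refine VectorMeasure.variation_le_of_forall_enorm_le fun s _ => ?_
    rw [Measure.add_apply]
    have h1 := SignedMeasure.enorm_le_totalVariation (ComplexMeasure.re c) s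
    have h2 := SignedMeasure.enorm_le_totalVariation (ComplexMeasure.im c) s
    refine le_trans ?_ (add_le_add h1 h2)
    have hc : c s = (((ComplexMeasure.re c) s : ℝ) : ℂ) +
        (((ComplexMeasure.im c) s : ℝ) : ℂ) * Complex.I := (Complex.re_add_im (c s)).symm
    rw [hc]
    refine (enorm_add_le _ _).trans_eq ?_
    simp [← ofReal_norm]
  exact isFiniteMeasure_of_le _ hle

theorem mutuallySingular_variation {n : ℕ} {σ : ComplexMeasure (Torus n)}
    (h : VectorMeasure.MutuallySingular σ (haarTorus n).toENNRealVectorMeasure) :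
    σ.variation ⟂ₘ haarTorus n := by
  obtain ⟨s, hs, h1, h2⟩ := h
  refine ⟨s, hs, (VectorMeasure.variation_apply_eq_zero hs).2 fun t ht _ => h1 t ht, ?_⟩
  rw [← Measure.toENNRealVectorMeasure_apply_measurable hs.compl]
  exact h2 _ subset_rfl

/-- Integration of a bounded function against a complex measure with a density. -/
theorem integral_withDensityᵥ_mul {X : Type*} [MeasurableSpace X] {m : Measure X} {f g : X → ℂ}
    (hf : Integrable f m) (hg : StronglyMeasurable g) {C : ℝ} (hC : ∀ x, ‖g x‖ ≤ C) :
    VectorMeasure.integral (m.withDensityᵥ f) g (ContinuousLinearMap.mul ℝ ℂ) =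
      ∫ x, g x * f x ∂m := by
  set ν : ComplexMeasure X := m.withDensityᵥ f with hν
  -- The identity is checked on simple functions and then passed to g by dominated convergence on
  -- both sides.
  have hsimple : ∀ F : SimpleFunc X ℂ,
      VectorMeasure.integral ν F (ContinuousLinearMap.mul ℝ ℂ) = ∫ x, F x * f x ∂m := by
    have hint : ∀ F : SimpleFunc X ℂ, ν.Integrable F ∧ Integrable (fun x => F x * f x) m := by
      intro F
      obtain ⟨D, hD⟩ := F.exists_forall_norm_le
      exact ⟨Integrable.of_bound F.stronglyMeasurable.aestronglyMeasurable D
        (Eventually.of_forall hD),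
        hf.bdd_mul F.stronglyMeasurable.aestronglyMeasurable (Eventually.of_forall hD)⟩
    intro F
    induction F using SimpleFunc.induction with
    | const c hs =>
      rename_i s
      have hcoe : ⇑(SimpleFunc.piecewise s hs (SimpleFunc.const X c) (SimpleFunc.const X 0)) =
          s.indicator fun _ => c := by
        ext x; simp [Set.indicator, Set.piecewise]
      rw [hcoe, VectorMeasure.integral, setToFun_indicator_const _ hs (measure_ne_top _ _)]
      have hR : ∀ x, s.indicator (fun _ => c) x * f x = s.indicator (fun x => c * f x) x :=
        fun x => by by_cases hx : x ∈ s <;> simp [hx]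
      simp only [hR]
      rw [integral_indicator hs, integral_const_mul, ← withDensityᵥ_apply hf hs]
      rfl
    | add hd hF hG =>
      rename_i F G
      have h1 := hint F
      have h2 := hint G
      rw [SimpleFunc.coe_add, VectorMeasure.integral_add h1.1 h2.1, hF, hG,
        ← integral_add h1.2 h2.2]
      simp only [Pi.add_apply, add_mul]
  -- A point of X is needed to know that the bound C is nonnegative.
  rcases isEmpty_or_nonempty X with hX | ⟨⟨x₀⟩⟩
  · rw [VectorMeasure.integral_of_isEmpty, Measure.eq_zero_of_isEmpty m, integral_zero_measure]
  have hC0 : 0 ≤ C := (norm_nonneg _).trans (hC x₀)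
  have h1 : Tendsto
      (fun k => VectorMeasure.integral ν (hg.approxBounded C k) (ContinuousLinearMap.mul ℝ ℂ))
      atTop (𝓝 (VectorMeasure.integral ν g (ContinuousLinearMap.mul ℝ ℂ))) :=
    VectorMeasure.tendsto_integral_of_dominated_convergence (fun _ => C)
    (fun k => (hg.approxBounded C k).stronglyMeasurable.aestronglyMeasurable)
    (integrable_const C) (fun k => Eventually.of_forall (hg.norm_approxBounded_le hC0 k))
    (Eventually.of_forall fun x => hg.tendsto_approxBounded_of_norm_le (hC x))
  have h2 := tendsto_integral_of_dominated_convergence (μ := m)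
    (F := fun k x => hg.approxBounded C k x * f x) (f := fun x => g x * f x)
    (fun x => C * ‖f x‖)
    (fun k => (hg.approxBounded C k).stronglyMeasurable.aestronglyMeasurable.mul hf.1)
    (hf.norm.const_mul C) (fun k => Eventually.of_forall fun x => by
      rw [norm_mul]
      gcongr
      exact hg.norm_approxBounded_le hC0 k x)
    (Eventually.of_forall fun x => (hg.tendsto_approxBounded_of_norm_le (hC x)).mul_const _)
  simp only [hsimple] at h1
  exact tendsto_nhds_unique h1 h2

theorem continuous_abPoissonKernel {n : ℕ} (α β : Fin n → ℂ) {z : Fin n → ℂ}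
    (hz : ∀ j, ‖z j‖ < 1) : Continuous fun η : Torus n => abPoissonKernel α β z η := by
  have hcoe : Continuous fun ξ : Circle => (ξ : ℂ) := continuous_subtype_val
  refine continuous_finsetProd _ fun j _ => ?_
  have hη : Continuous fun η : Torus n => (η j : ℂ) := hcoe.comp (continuous_apply j)
  have hη' : Continuous fun η : Torus n => conj (η j : ℂ) := Complex.continuous_conj.comp hη
  have h1 : ∀ η : Torus n, 1 - z j * conj (η j : ℂ) ∈ Complex.slitPlane := fun η => by
    rw [sub_eq_add_neg]
    exact Complex.mem_slitPlane_of_norm_lt_one (by simpa [Circle.norm_coe] using hz j)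
  have h2 : ∀ η : Torus n, 1 - conj (z j) * (η j : ℂ) ∈ Complex.slitPlane := fun η => by
    rw [sub_eq_add_neg]
    exact Complex.mem_slitPlane_of_norm_lt_one (by simpa [Circle.norm_coe] using hz j)
  refine continuous_const.mul (continuous_const.div ?_ fun η => ?_)
  · exact (Continuous.cpow (continuous_const.sub (continuous_const.mul hη')) continuous_const h1).mul
      (Continuous.cpow (continuous_const.sub (continuous_const.mul hη)) continuous_const h2)
  · exact mul_ne_zero
      (fun h => Complex.slitPlane_ne_zero (h1 η) ((Complex.cpow_eq_zero_iff _ _).1 h).1)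
      (fun h => Complex.slitPlane_ne_zero (h2 η) ((Complex.cpow_eq_zero_iff _ _).1 h).1)

theorem integral_abPoissonKernel {n : ℕ} (α β : Fin n → ℂ) {z : Fin n → ℂ}
    (hz : ∀ j, ‖z j‖ < 1) :
    ∫ η, abPoissonKernel α β z η ∂haarTorus n =
      ∏ j, coef (α j) (β j) * (((1 - ‖z j‖ ^ 2 : ℝ) : ℂ) ^ (α j + β j + 1) *
        ∑' k, risingCoeff (α j + 1) k * risingCoeff (β j + 1) k *
          ((‖z j‖ ^ 2 : ℝ) : ℂ) ^ k) := by
  rw [haarTorus_eq_pi]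
  simp only [abPoissonKernel_eq_prod]
  rw [integral_fintype_prod_eq_prod (fun j ξ => poissonFactor (α j) (β j) (z j) ξ)]
  exact Finset.prod_congr rfl fun j _ => integral_poissonFactor _ _ (hz j)

/-- The distance of the Poisson integral to `f(ζ)` is controlled by the kernel's integral against
the oscillation measure at `ζ` and by the defect of the kernel's total mass. -/
theorem enorm_abPoissonIntegral_sub_le {n : ℕ} (α β : Fin n → ℂ) {μ σ : ComplexMeasure (Torus n)}
    {f : Torus n → ℂ} (hμ : IsLebesgueDecomposition μ f σ) (ζ : Torus n) {z : Fin n → ℂ}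
    (hz : ∀ j, ‖z j‖ < 1) :
    ‖abPoissonIntegral α β μ z - f ζ‖ₑ ≤
      ∫⁻ η, ‖abPoissonKernel α β z η‖ₑ ∂oscMeasure f σ.variation ζ +
        ‖f ζ‖ₑ * ‖∫ η, abPoissonKernel α β z η ∂haarTorus n - 1‖ₑ := by
  set K : Torus n → ℂ := fun η => abPoissonKernel α β z η with hK
  have hf := hμ.integrable
  have hcont : Continuous K := continuous_abPoissonKernel α β hz
  obtain ⟨C, hC⟩ : ∃ C, ∀ η, ‖K η‖ ≤ C := by
    obtain ⟨C, hC⟩ := isCompact_univ.exists_bound_of_continuousOn hcont.continuousOn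
    exact ⟨C, fun η => hC η (mem_univ η)⟩
  have hsm : StronglyMeasurable K := hcont.stronglyMeasurable
  have hKint : ∀ ν : Measure (Torus n), IsFiniteMeasure ν → Integrable K ν := fun ν _ =>
    Integrable.of_bound hsm.aestronglyMeasurable C (Eventually.of_forall hC)
  have hKf : Integrable (fun η => K η * f η) (haarTorus n) :=
    hf.bdd_mul hsm.aestronglyMeasurable (Eventually.of_forall hC)
  have hsplit : abPoissonIntegral α β μ z - f ζ =
      ∫ η, K η * (f η - f ζ) ∂haarTorus n +
        VectorMeasure.integral σ K (ContinuousLinearMap.mul ℝ ℂ) +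
        f ζ * (∫ η, K η ∂haarTorus n - 1) := by
    have e1 : ∫ η, K η * (f η - f ζ) ∂haarTorus n =
        ∫ η, K η * f η ∂haarTorus n - (∫ η, K η ∂haarTorus n) * f ζ := by
      simp only [mul_sub]
      rw [integral_sub hKf ((hKint _ inferInstance).mul_const _), integral_mul_const]
    rw [abPoissonIntegral, hμ.eq_add,
      VectorMeasure.integral_add_vectorMeasure (hKint _ inferInstance) (hKint _ inferInstance),
      integral_withDensityᵥ_mul hf hsm hC, e1]
    ring
  have hσ : ‖VectorMeasure.integral σ K (ContinuousLinearMap.mul ℝ ℂ)‖ₑ ≤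
      ∫⁻ η, ‖K η‖ₑ ∂σ.variation := by
    refine VectorMeasure.enorm_integral_le_lintegral_enorm.trans ?_
    have : ‖ContinuousLinearMap.mul ℝ ℂ‖ₑ ≤ 1 := by
      rw [← ofReal_norm, ENNReal.ofReal_le_one]
      exact ContinuousLinearMap.opNorm_mul_le ℝ ℂ
    exact mul_le_of_le_one_left' this
  have hosc : ∫⁻ η, ‖K η‖ₑ ∂oscMeasure f σ.variation ζ =
      ∫⁻ η, ‖K η * (f η - f ζ)‖ₑ ∂haarTorus n + ∫⁻ η, ‖K η‖ₑ ∂σ.variation := by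
    have hm : AEMeasurable (fun η => ‖f η - f ζ‖ₑ) (haarTorus n) :=
      (hf.1.sub aestronglyMeasurable_const).enorm
    rw [oscMeasure, lintegral_add_measure,
      lintegral_withDensity_eq_lintegral_mul₀ hm hsm.enorm.aemeasurable]
    congr 1
    refine lintegral_congr fun η => ?_
    rw [Pi.mul_apply, enorm_mul, mul_comm]
  rw [hsplit, hosc]
  refine (enorm_add_le _ _).trans (add_le_add ((enorm_add_le _ _).trans
    (add_le_add (enorm_integral_le_lintegral_enorm _) hσ)) ?_)
  rw [enorm_mul]

/-! ### Limits along restricted Stolz cones -/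

theorem tendsto_norm_of_stolz {n : ℕ} {A B : ℝ} (ζ : Torus n) (j : Fin n) :
    Tendsto (fun z : Fin n → ℂ => ‖z j‖) (𝓝[restrictedStolz A B ζ] (toComplex ζ)) (𝓝[<] 1) := by
  refine tendsto_nhdsWithin_iff.2 ⟨?_, ?_⟩
  · have h : Tendsto (fun z : Fin n → ℂ => ‖z j‖) (𝓝 (toComplex ζ)) (𝓝 ‖toComplex ζ j‖) :=
      ((continuous_apply j).norm).tendsto _
    rw [toComplex, Circle.norm_coe] at h
    exact h.mono_left nhdsWithin_le_nhds
  · filter_upwards [self_mem_nhdsWithin] with z hz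
    exact (norm_lt_one_of_mem_stolz (hz.1 j)).1

theorem tendsto_integral_abPoissonKernel {n : ℕ} {α β : Fin n → ℂ}
    (hre : ∀ j, -1 < (α j).re + (β j).re)
    (hα : ∀ j, ∀ k : ℕ, α j ≠ -((k : ℂ) + 1)) (hβ : ∀ j, ∀ k : ℕ, β j ≠ -((k : ℂ) + 1))
    (A B : ℝ) (ζ : Torus n) :
    Tendsto (fun z => ∫ η, abPoissonKernel α β z η ∂haarTorus n)
      (𝓝[restrictedStolz A B ζ] (toComplex ζ)) (𝓝 1) := by
  have hsq : Tendsto (fun x : ℝ => x ^ 2) (𝓝[<] 1) (𝓝[<] 1) := by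
    refine tendsto_nhdsWithin_iff.2 ⟨?_, ?_⟩
    · have : Tendsto (fun x : ℝ => x ^ 2) (𝓝 1) (𝓝 (1 ^ 2)) := (continuous_pow 2).tendsto 1
      rw [one_pow] at this
      exact this.mono_left nhdsWithin_le_nhds
    · filter_upwards [Ioo_mem_nhdsLT (zero_lt_one' ℝ)] with x hx
      exact pow_lt_one₀ hx.1.le hx.2 two_ne_zero
  have hprod := tendsto_finsetProd (Finset.univ : Finset (Fin n)) fun j _ =>
    (tendsto_poissonFactor_series (hre j) (hα j) (hβ j)).comp
      (hsq.comp (tendsto_norm_of_stolz (A := A) (B := B) ζ j))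
  rw [Finset.prod_const_one] at hprod
  refine hprod.congr' ?_
  filter_upwards [self_mem_nhdsWithin] with z hz
  exact (integral_abPoissonKernel α β fun j => (norm_lt_one_of_mem_stolz (hz.1 j)).1).symm

/-- The scale is r = 1 - |z_0|. The bound B on the ratios makes every 1 - |z_j| comparable to it;
this is where the restriction on the approach is used. -/
theorem tendsto_lintegral_abPoissonKernel {n : ℕ} {α β : Fin n → ℂ} {A B ε : ℝ} (hA : 0 < A)
    (hB : 1 ≤ B) (hε0 : 0 < ε) (hε : ∀ j, ε ≤ (α j).re + (β j).re + 1) {ζ : Torus n}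
    {ρ : Measure (Torus n)}
    (hρ : Tendsto (fun r => ∑' k : Fin n → ℕ, ENNReal.ofReal ((2 : ℝ) ^ (-ε)) ^ (∑ j, k j) *
      (ρ (box k r ζ) / ENNReal.ofReal (boxSize k r))) (𝓝[>] 0) (𝓝 0)) :
    Tendsto (fun z => ∫⁻ η, ‖abPoissonKernel α β z η‖ₑ ∂ρ)
      (𝓝[restrictedStolz A B ζ] (toComplex ζ)) (𝓝 0) := by
  obtain ⟨C, hCtop, hC⟩ := exists_lintegral_kernel_le α β hA hB hε0 hε
  have hlim := ENNReal.Tendsto.const_mul (a := C) hρ (.inr hCtop)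
  rw [mul_zero] at hlim
  rw [ENNReal.tendsto_nhds_zero] at hlim ⊢
  intro δ hδ
  have hev := hlim δ hδ
  -- For n = 0 no coordinate supplies a scale, but any small r serves.
  rcases n.eq_zero_or_pos with rfl | hn
  · obtain ⟨r, hr, hr0⟩ := (hev.and self_mem_nhdsWithin).exists
    filter_upwards with z
    exact (hC r ζ z hr0 (fun j => j.elim0) (fun j => j.elim0) (fun j => j.elim0) ρ).trans hr
  · have hr : Tendsto (fun z : Fin n → ℂ => 1 - ‖z ⟨0, hn⟩‖)
        (𝓝[restrictedStolz A B ζ] (toComplex ζ)) (𝓝[>] 0) := by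
      have h := tendsto_norm_of_stolz (A := A) (B := B) ζ ⟨0, hn⟩
      refine tendsto_nhdsWithin_iff.2 ⟨?_, ?_⟩
      · have := (tendsto_nhds_of_tendsto_nhdsWithin h).const_sub 1
        rwa [sub_self] at this
      · filter_upwards [eventually_mem_of_tendsto_nhdsWithin h] with z hz
        exact sub_pos.2 (mem_Iio.1 hz)
    filter_upwards [hr.eventually hev, self_mem_nhdsWithin] with z hz hzS
    have hpos : ∀ j, 0 < 1 - ‖z j‖ := fun j =>
      sub_pos.2 (norm_lt_one_of_mem_stolz (hzS.1 j)).1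
    refine (hC _ ζ z (hpos ⟨0, hn⟩) hzS.1 (fun j => ?_) (fun j => ?_) ρ).trans hz
    · exact (div_le_iff₀ (hpos j)).1 (hzS.2 _ _)
    · exact (div_le_iff₀ (hpos _)).1 (hzS.2 _ _)

end PolydiscPoisson

end

theorem corollary4p9 (n : ℕ) (α β : Fin n → ℂ)
    (hre : ∀ j, -1 < (α j).re + (β j).re)
    (hα : ∀ j, ∀ k : ℕ, α j ≠ -((k : ℂ) + 1))
    (hβ : ∀ j, ∀ k : ℕ, β j ≠ -((k : ℂ) + 1))
    (μ σ : ComplexMeasure (PolydiscPoisson.Torus n))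
    (f : PolydiscPoisson.Torus n → ℂ)
    (hμ : PolydiscPoisson.IsLebesgueDecomposition μ f σ) :
    ∀ᵐ ζ ∂(PolydiscPoisson.haarTorus n),
      PolydiscPoisson.HasRestrictedNTLimit
        (PolydiscPoisson.abPoissonIntegral α β μ) ζ (f ζ) := by
  open PolydiscPoisson in
  obtain ⟨ε, hε0, hε⟩ : ∃ ε : ℝ, 0 < ε ∧ ∀ j, ε ≤ (α j).re + (β j).re + 1 := by
    have h : ∀ᶠ ε in 𝓝[>] (0 : ℝ), ∀ j, ε ≤ (α j).re + (β j).re + 1 :=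
      eventually_all.2 fun j =>
        Eventually.mono
          (Ioc_mem_nhdsGT (show (0 : ℝ) < (α j).re + (β j).re + 1 by linarith [hre j]))
          fun x hx => hx.2
    obtain ⟨ε, hε, hε0⟩ := (h.and self_mem_nhdsWithin).exists
    exact ⟨ε, hε0, hε⟩
  -- The decay 2^{-ε} is split as q² with q = 2^{-ε/2}: one q for the maximal bound, one for
  -- summability.
  have hpos : (0 : ℝ) < 2 ^ (-(ε / 2)) := by positivity
  have hq0 : ENNReal.ofReal ((2 : ℝ) ^ (-(ε / 2))) ≠ 0 := by simpa using hpos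
  have hq : ENNReal.ofReal ((2 : ℝ) ^ (-(ε / 2))) < 1 := by
    rw [ENNReal.ofReal_lt_one]
    exact Real.rpow_lt_one_of_one_lt_of_neg one_lt_two (by linarith)
  have hqq : ENNReal.ofReal ((2 : ℝ) ^ (-(ε / 2))) ^ 2 = ENNReal.ofReal ((2 : ℝ) ^ (-ε)) := by
    rw [← ENNReal.ofReal_pow hpos.le, ← Real.rpow_natCast, ← Real.rpow_mul (by norm_num)]
    congr 2
    push_cast
    ring
  -- The exceptional null set is fixed before A and B, so one set serves all cones.
  filter_upwards [ae_tendsto_tsum_oscMeasure_box hμ.integrable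
    (mutuallySingular_variation hμ.singular) hq0 hq] with ζ hζ A B hA hB
  rw [hqq] at hζ
  have h1 := tendsto_lintegral_abPoissonKernel hA hB hε0 hε hζ
  have h2 : Tendsto (fun z => ‖f ζ‖ₑ * ‖∫ η, abPoissonKernel α β z η ∂haarTorus n - 1‖ₑ)
      (𝓝[restrictedStolz A B ζ] (toComplex ζ)) (𝓝 0) := by
    have h3 := ((tendsto_integral_abPoissonKernel hre hα hβ A B ζ).sub_const 1).enorm
    rw [sub_self, enorm_zero] at h3
    have h4 := ENNReal.Tendsto.const_mul (a := ‖f ζ‖ₑ) h3 (.inr enorm_ne_top)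
    rwa [mul_zero] at h4
  have h5 := h1.add h2
  rw [add_zero] at h5
  rw [tendsto_iff_edist_tendsto_0]
  refine tendsto_of_tendsto_of_tendsto_of_le_of_le' tendsto_const_nhds h5
    (Eventually.of_forall fun _ => zero_le) ?_
  filter_upwards [self_mem_nhdsWithin] with z hz
  rw [edist_eq_enorm_sub]
  exact enorm_abPoissonIntegral_sub_le α β hμ ζ fun j => (norm_lt_one_of_mem_stolz (hz.1 j)).1
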